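/- **Setting.** Let $G$ be a finite graph embedded in the plane, with vertices $s,t$. Every edge consists of two opposite darts $d$, $\mathrm{rev}(d)$. A path is a sequence of darts, each starting where the previous one ends; a simple path visits no vertex twice, and a trivial path is a single vertex. The infinite face $f_\infty$ is a face incident to $t$. Let $c$ assign a real (residual) capacity to every dart. A path or cycle is *residual* if $c(d)>0$ for each of its darts $d$. A flow assignment $\theta$ (a real function on darts with $\theta(\mathrm{rev}(d))=-\theta(d)$) is a *clockwise circulation* if there is a potential $\varphi\ge 0$ on the faces with $\varphi(f_\infty)=0$ and $\theta(d)=\varphi(\text{face right of }d)-\varphi(\text{face left of }d)$ for every dart $d$. A simple cycle (one that repeats no vertex and does not use both darts of an edge) is *clockwise* if sending one unit of flow along it is a clockwise circulation. Assume that $c$ is *clockwise acyclic*: no clockwise simple cycle is residual. An $s$-to-$t$ path $A$ is *left of* an $s$-to-$t$ path $B$ if sending one unit along $A$ and one unit along $\mathrm{rev}(B)$ is a clockwise circulation. A simple residual $s$-to-$t$ path is *leftmost* if no other simple residual $s$-to-$t$ path is left of it. **Crossings.** Let $P,Q$ be simple paths. If $a,b$ are consecutive darts of $Q$ meeting at a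 vertex $v$, a dart of $P$ with head (resp. tail) $v$ enters (resp. leaves) $Q$ *from the right* at $v$ if it lies strictly after $b$ and strictly before $a$ in the clockwise order around $v$, and *from the left* if it lies strictly after $a$ and strictly before $b$. $P$ *crosses $Q$ from right to left at $X$* if $X$ is a maximal subpath of $Q$ (possibly a single vertex) such that $X$ or $\mathrm{rev}(X)$ is a subpath of $P$, and $P$ enters $Q$ from the right at the endpoint of $X$ that $P$ reaches first and leaves $Q$ from the left at the endpoint of $X$ that $P$ reaches last. Crossing from left to right is defined by exchanging left and right. Let $P\otimes Q$ be the sequence of all crossings $X$ of $Q$ by $P$ (in either direction), in the order in which they occur along $Q$; so $Q\otimes P$ lists the crossings of $P$ by $Q$, as subpaths of $P$, in their order along $P$. **Theorem (Leftmost Crossings).** Let $P$ be the leftmost simple residual $s$-to-$t$ path with respect to the clockwise-acyclic capacities $c$, and let $Q$ be a simple $s$-to-$t$ path such that $\mathrm{rev}(Q)$ is residual with respect to $c$. Then: 1. The order of the crossings is the same along $P$ and $Q$: the sequences $P\otimes Q$ and $Q\otimes P$ have the same length, and if $X$ and $Y$ are their $i$-th members, then $X=Y$ or $X=\mathrm{rev}(Y)$.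 2. $P$ crosses $Q$ from right to left at $X$ for every $X\in P\otimes Q$. -/

import Mathlib

/-- A finite plane graph (loops, parallel edges and several components are allowed), given by its
embedding data: darts `D` with reversal, vertices `V`, faces `F`, the clockwise rotation of the
darts around their tails, and the face to the right of each dart. An edge is a pair
`{d, rev d}`; the face to the left of `d` is the face to the right of `rev d`. -/
structure PlaneGraph (V D F : Type*) [Fintype V] [Fintype D] [Fintype F] where
  /-- the oppositely directed dart of the same edge -/
  rev : D → D
  rev_rev : ∀ d, rev (rev d) = d
  rev_ne : ∀ d, rev d ≠ d
  tail : D → V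
  /-- `rot d` is the next dart after `d` in clockwise order among the darts with tail `tail d` -/
  rot : Equiv.Perm D
  rot_sameCycle : ∀ d d', rot.SameCycle d d' ↔ tail d = tail d'
  /-- the face on the right-hand side of a dart -/
  right : D → F
  /-- the corner between `d` and `rot d` lies to the right of `d` and to the left of `rot d` -/
  right_corner : ∀ d, right (rev (rot d)) = right d
  /-- the dual graph is connected -/
  dual_connected :
    ∀ f g : F, Relation.EqvGen (fun x y => ∃ d, right d = x ∧ right (rev d) = y) f g
  /-- Euler's formula `|V| + |F| = |E| + (number of components) + 1` (with `|D| = 2 |E|`) -/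
  euler :
    2 * (Fintype.card V + Fintype.card F) =
      Fintype.card D + 2 * (Nat.card (Quot fun u v : V => ∃ d, tail d = u ∧ tail (rev d) = v) + 1)

/-- A sequence of darts with a start vertex (so that trivial paths have a vertex). -/
@[ext]
structure DartPath (V D : Type*) where
  start : V
  darts : List D

namespace PlaneGraph

variable {V D F : Type*} [Fintype V] [Fintype D] [Fintype F] (G : PlaneGraph V D F)

/-- The vertex a dart points to. -/
def head (d : D) : V := G.tail (G.rev d)

/-- `l` is the dart sequence of a walk from `u` to `v`. -/
def IsWalk : V → List D → V → Prop
  | u, [], v => u = v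
  | u, d :: l, v => G.tail d = u ∧ IsWalk (G.head d) l v

/-- The last vertex of a path. -/
def finish (P : DartPath V D) : V := (P.darts.map G.head).getLastD P.start

/-- The sequence of vertices of a path. -/
def support (P : DartPath V D) : List V := P.start :: P.darts.map G.head

/-- The reverse path. -/
def revPath (P : DartPath V D) : DartPath V D :=
  ⟨G.finish P, (P.darts.map G.rev).reverse⟩

/-- `P` is a simple `s`-to-`t` path. -/
def IsSimplePath (s t : V) (P : DartPath V D) : Prop :=
  P.start = s ∧ G.IsWalk s P.darts t ∧ (G.support P).Nodup

/-- `C` is the dart sequence of a simple cycle: a nonempty closed walk that repeats no vertex and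
does not use an edge in both directions. -/
def IsSimpleCycle (C : List D) : Prop :=
  C ≠ [] ∧ (∃ v, G.IsWalk v C v) ∧ (C.map G.tail).Nodup ∧ ∀ d ∈ C, G.rev d ∉ C

/-! ### Clockwise circulations, leftmost paths -/

open Classical in
/-- The antisymmetric flow assignment that sends one unit along each dart of `l`. -/
noncomputable def unitFlow (l : List D) (d : D) : ℝ :=
  (l.count d : ℝ) - (l.count (G.rev d) : ℝ)

/-- The flow assignment `θ` is a clockwise circulation with respect to the infinite face `fInf`:
it is the difference (right minus left) of a nonnegative potential on the faces that vanishes on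
the infinite face. -/
def IsClockwise (fInf : F) (θ : D → ℝ) : Prop :=
  ∃ φ : F → ℝ, φ fInf = 0 ∧ (∀ f, 0 ≤ φ f) ∧ ∀ d, θ d = φ (G.right d) - φ (G.right (G.rev d))

/-- Every dart of `l` has positive (residual) capacity. -/
def Residual (c : D → ℝ) (l : List D) : Prop := ∀ d ∈ l, 0 < c d

/-- The (residual) capacities `c` are clockwise acyclic: no clockwise cycle is residual. -/
def ClockwiseAcyclic (fInf : F) (c : D → ℝ) : Prop :=
  ∀ C, G.IsSimpleCycle C → Residual c C → ¬ G.IsClockwise fInf (G.unitFlow C)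

/-- The path `A` is left of the path `B`: `A` together with the reverse of `B` is a clockwise
circulation. -/
def IsLeftOf (fInf : F) (A B : DartPath V D) : Prop :=
  G.IsClockwise fInf (G.unitFlow (A.darts ++ (G.revPath B).darts))

/-- `P` is a leftmost residual (simple) `s`-to-`t` path: no other one is left of it. -/
def IsLeftmostResidual (fInf : F) (c : D → ℝ) (s t : V) (P : DartPath V D) : Prop :=
  G.IsSimplePath s t P ∧ Residual c P.darts ∧
    ∀ A, G.IsSimplePath s t A → Residual c A.darts → A ≠ P → ¬ G.IsLeftOf fInf A P

/-! ### Crossings -/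

/-- Turning clockwise around a vertex from the outgoing dart `x`, one meets the outgoing dart `y`,
and `z` is not met up to then (so that, for distinct `x`, `y`, `z` at one vertex, the clockwise
order is `x`, `y`, `z`). -/
def CwOrder (x y z : D) : Prop :=
  ∃ n : ℕ, G.rot^[n + 1] x = y ∧ ∀ m ≤ n, G.rot^[m + 1] x ≠ z

/-- `P` enters `Q` from the right at `v`: for some dart `e` of `P` with head `v` and some
consecutive darts `a, b` of `Q` meeting at `v`, the clockwise order around `v` is `a, b, e`. -/
def EntersRight (P Q : DartPath V D) (v : V) : Prop :=
  ∃ e ∈ P.darts, ∃ a b, [a, b] <:+: Q.darts ∧ G.head a = v ∧ G.tail b = v ∧ G.head e = v ∧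
    G.CwOrder b (G.rev e) (G.rev a)

/-- `P` enters `Q` from the left at `v`: the clockwise order is `a, e, b`. -/
def EntersLeft (P Q : DartPath V D) (v : V) : Prop :=
  ∃ e ∈ P.darts, ∃ a b, [a, b] <:+: Q.darts ∧ G.head a = v ∧ G.tail b = v ∧ G.head e = v ∧
    G.CwOrder (G.rev a) (G.rev e) b

/-- `P` leaves `Q` from the right at `v`. -/
def LeavesRight (P Q : DartPath V D) (v : V) : Prop :=
  ∃ e ∈ P.darts, ∃ a b, [a, b] <:+: Q.darts ∧ G.head a = v ∧ G.tail b = v ∧ G.tail e = v ∧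
    G.CwOrder b e (G.rev a)

/-- `P` leaves `Q` from the left at `v`. -/
def LeavesLeft (P Q : DartPath V D) (v : V) : Prop :=
  ∃ e ∈ P.darts, ∃ a b, [a, b] <:+: Q.darts ∧ G.head a = v ∧ G.tail b = v ∧ G.tail e = v ∧
    G.CwOrder (G.rev a) e b

/-- The subpath of `Q` between its `i`-th and its `j`-th vertex. -/
def subpath (Q : DartPath V D) (i j : ℕ) : DartPath V D :=
  ⟨G.finish ⟨Q.start, Q.darts.take i⟩, (Q.darts.take j).drop i⟩

/-- `X` is a subpath of `Q` (possibly trivial). -/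
def IsSubpath (X Q : DartPath V D) : Prop :=
  ∃ i j, i ≤ j ∧ j ≤ Q.darts.length ∧ X = G.subpath Q i j

/-- `X` is a maximal subpath of `Q` such that `X` or its reverse is a subpath of `P`. -/
def IsMaxShared (P Q X : DartPath V D) : Prop :=
  G.IsSubpath X Q ∧ (G.IsSubpath X P ∨ G.IsSubpath (G.revPath X) P) ∧
    ∀ X', G.IsSubpath X' Q → (G.IsSubpath X' P ∨ G.IsSubpath (G.revPath X') P) →
      G.IsSubpath X X' → X' = X

/-- `P` crosses `Q` from right to left at `X`. `P` enters at the end of `X` where it first meets `X`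
and leaves at the other one; which is which depends on the direction in which `P` runs along `X`. -/
def CrossesRightToLeft (P Q X : DartPath V D) : Prop :=
  G.IsMaxShared P Q X ∧
    ((G.IsSubpath X P ∧ G.EntersRight P Q X.start ∧ G.LeavesLeft P Q (G.finish X)) ∨
      (G.IsSubpath (G.revPath X) P ∧ G.EntersRight P Q (G.finish X) ∧ G.LeavesLeft P Q X.start))

/-- `P` crosses `Q` from left to right at `X`. -/
def CrossesLeftToRight (P Q X : DartPath V D) : Prop :=
  G.IsMaxShared P Q X ∧
    ((G.IsSubpath X P ∧ G.EntersLeft P Q X.start ∧ G.LeavesRight P Q (G.finish X)) ∨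
      (G.IsSubpath (G.revPath X) P ∧ G.EntersLeft P Q (G.finish X) ∧ G.LeavesRight P Q X.start))

/-- All subpaths of `Q`, listed in the order of their first vertex along `Q`. -/
def subpaths (Q : DartPath V D) : List (DartPath V D) :=
  (List.range (Q.darts.length + 1)).flatMap fun i =>
    (List.range (Q.darts.length + 1 - i)).map fun k => G.subpath Q i (i + k)

open Classical in
/-- The sequence `P ⊗ Q` of the subpaths of `Q` at which `P` crosses `Q` (in either direction), in
the order in which they occur along `Q`. -/
noncomputable def crossings (P Q : DartPath V D) : List (DartPath V D) :=
  (G.subpaths Q).filter fun X =>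
    decide (G.CrossesRightToLeft P Q X ∨ G.CrossesLeftToRight P Q X)

end PlaneGraph

/-!
Circulations are handled through face potentials. In a plane graph every circulation `θ` has a
potential `φ` with `φ fInf = 0`: the potential differences form a subspace of the circulations, and
by Euler's formula the two spaces have the same dimension (`exists_rat_potential`,
`exists_potential`). All flows below are integral.

The hypotheses on `c` and `P` become two inequalities. As `c` is clockwise acyclic, every residual
circulation has a potential `φ ≤ 0` (`ClockwiseAcyclic.potential_nonpos`): truncating `φ` at zero
gives another residual circulation, and if that one were nonzero, splitting off simple cycles would
produce a clockwise one. As `P` is leftmost, every circulation `θ` for which `P + θ` is a residual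
flow also has a potential `φ ≤ 0` (`IsLeftmostResidual.potential_nonpos`): a positive part could be
added to `P`, and the resulting flow would contain a residual path left of `P`.

Locally, if `a`, `b` are consecutive darts of `Q`, then `φ (right a) - φ (right b)` is the net flow
that leaves to the right of `Q` at their common vertex (`IsPotential.sub_eq_sum_cwOrder`). For a
flow along a part of `P`, these differences add up to zero over a maximal shared subpath that is not
a crossing. Since `t` lies on the infinite face, the potential vanishes around `t`, and it can be
followed from there back along `Q` as long as no crossing intervenes (`IsPotential.right_eq_zero`).

This is applied to two circulations. For a crossing `X`, let `x` be its first vertex on `P`; `P`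
from `s` to `x` followed by the reverse of `Q` from `x` to `s` is residual, so its potential is at
most `0`. If all crossings after `X` on `Q` are also after `X` on `P`, the potential is `0` to the
right of `Q` at `x`, and `P` cannot enter from the left, because the potential would be `1` to the
left of `Q` (`not_entersLeft`). Next, let `Z` be after `Y` on `Q` but before `Y` on `P`; `P` from
`Z` to `Y` followed by `Q` from `Y` to `Z` has a potential `≥ 0`, as `P` is leftmost. If `Z` is the
last such crossing on `Q`, the potential is `0` to the right of `Q` at `Z`, and `P` cannot leave to
the left there (`not_leavesLeft`). Going through the crossings backwards along `Q`, these two facts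
contradict each other at the last crossing `Z` that is out of order with respect to `Y`, so the
orders agree (`CrossesAt.lt_of_lt`), and then every crossing is from right to left
(`CrossesAt.entersRight`).
-/

namespace PlaneGraph

variable {V D F : Type*} [Fintype V] [Fintype D] [Fintype F] (G : PlaneGraph V D F)

/-! ### Circulations and face potentials -/

/-- `φ` is a potential of the flow assignment `θ`. -/
def IsPotential {R : Type*} [Sub R] (φ : F → R) (θ : D → R) : Prop :=
  ∀ d, θ d = φ (G.right d) - φ (G.right (G.rev d))

open Classical in
/-- The net flow out of the vertex `v`. -/
noncomputable def outflow {R : Type*} [AddCommMonoid R] (θ : D → R) (v : V) : R :=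
  ∑ d with G.tail d = v, θ d

variable {G}

theorem IsPotential.rev {R : Type*} [AddCommGroup R] {φ : F → R} {θ : D → R}
    (h : G.IsPotential φ θ) (d : D) : θ (G.rev d) = -θ d := by
  rw [h, h, G.rev_rev, neg_sub]

theorem tail_rot (d : D) : G.tail (G.rot d) = G.tail d :=
  ((G.rot_sameCycle d (G.rot d)).1
    (Equiv.Perm.sameCycle_apply_right.2 (Equiv.Perm.SameCycle.refl _ _))).symm

/-- Potential differences are circulations: around a vertex they telescope. -/
theorem IsPotential.outflow_eq_zero {R : Type*} [AddCommGroup R] {φ : F → R} {θ : D → R}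
    (h : G.IsPotential φ θ) (v : V) : G.outflow θ v = 0 := by
  classical
  unfold outflow
  rw [Finset.sum_congr rfl fun d _ => h d, Finset.sum_sub_distrib, sub_eq_zero]
  refine Finset.sum_bij (fun d _ => G.rot d) ?_ ?_ ?_ ?_
  · intro d hd
    simpa [tail_rot] using hd
  · intro a _ b _ hab
    exact G.rot.injective hab
  · intro b hb
    refine ⟨G.rot.symm b, ?_, by simp⟩
    rw [← G.rot.apply_symm_apply b] at hb
    simpa only [Finset.mem_filter, Finset.mem_univ, true_and, tail_rot] using hb
  · intro d _
    rw [G.right_corner]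

variable (G)

/-- Each edge can be oriented, that is, one of its two darts can be chosen. -/
theorem exists_orientation :
    ∃ E : Finset D, (∀ d, d ∈ E ↔ G.rev d ∉ E) ∧ 2 * E.card = Fintype.card D := by
  classical
  let g := Fintype.equivFin D
  have hmem : ∀ d, d ∈ Finset.univ.filter (fun d => g d < g (G.rev d)) ↔
      G.rev d ∉ Finset.univ.filter (fun d => g d < g (G.rev d)) := by
    intro d
    have : g d ≠ g (G.rev d) := fun h => G.rev_ne d (g.injective h).symm
    simp only [Finset.mem_filter, Finset.mem_univ, true_and, G.rev_rev, not_lt]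
    exact ⟨le_of_lt, fun h => lt_of_le_of_ne h this⟩
  refine ⟨_, hmem, ?_⟩
  generalize Finset.univ.filter (fun d => g d < g (G.rev d)) = E at hmem
  have h : E.card = Eᶜ.card := by
    refine Finset.card_bij (fun d _ => G.rev d) ?_ ?_ ?_
    · intro d hd
      simpa using (hmem d).1 hd
    · intro a _ b _ hab
      rw [← G.rev_rev a, hab, G.rev_rev]
    · intro b hb
      refine ⟨G.rev b, ?_, G.rev_rev b⟩
      rw [hmem, G.rev_rev]
      simpa using hb
  have := Finset.card_add_card_compl E
  omega

/-- The outflow of an antisymmetric assignment, expressed on the darts of an orientation. -/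
theorem outflow_eq_sum_orientation {E : Finset D} (hE : ∀ d, d ∈ E ↔ G.rev d ∉ E) [DecidableEq V]
    {θ : D → ℚ} (hθ : ∀ d, θ (G.rev d) = -θ d) (v : V) :
    G.outflow θ v =
      ∑ e : E, ((if G.tail e = v then 1 else 0) - (if G.head e = v then 1 else 0)) * θ e := by
  classical
  have h1 : ∑ d ∈ Eᶜ, (if G.tail d = v then θ d else 0) =
      ∑ d ∈ E, (if G.head d = v then -θ d else 0) := by
    refine Finset.sum_nbij' G.rev G.rev ?_ ?_ ?_ ?_ ?_
    · intro d hd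
      rw [hE, G.rev_rev]
      simpa using hd
    · intro d hd
      simpa using (hE d).1 hd
    · intro d _; exact G.rev_rev d
    · intro d _; exact G.rev_rev d
    · intro d _
      simp [head, hθ, G.rev_rev]
  have h2 : G.outflow θ v = ∑ d, (if G.tail d = v then θ d else 0) := by
    unfold outflow
    rw [Finset.sum_filter]
    exact Finset.sum_congr rfl fun d _ => by split_ifs <;> rfl
  rw [h2, ← Finset.sum_add_sum_compl E, h1, ← Finset.sum_add_distrib,
    ← Finset.sum_coe_sort E]
  refine Finset.sum_congr rfl fun d _ => ?_
  split_ifs <;> ring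

/-- A function on the faces that takes equal values on both sides of every dart is constant. -/
theorem eq_of_forall_right_eq {R : Type*} {φ : F → R}
    (h : ∀ d, φ (G.right d) = φ (G.right (G.rev d))) (f g : F) : φ f = φ g := by
  induction G.dual_connected f g with
  | rel x y hxy => obtain ⟨d, rfl, rfl⟩ := hxy; exact h d
  | refl x => rfl
  | symm x y _ ih => exact ih.symm
  | trans x y z _ _ h1 h2 => exact h1.trans h2

/-- In a plane graph every circulation has a face potential: by Euler's formula the space of
circulations has the same dimension as the space of potential differences it contains. -/
theorem exists_rat_potential (fInf : F) {θ : D → ℚ} (hθ : ∀ d, θ (G.rev d) = -θ d)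
    (hout : ∀ v, G.outflow θ v = 0) : ∃ φ : F → ℚ, G.IsPotential φ θ := by
  classical
  obtain ⟨E, hE, hcard⟩ := G.exists_orientation
  -- `N` is the boundary map on oriented edges, `δ` takes a face function to its differences
  let N : Matrix V E ℚ := Matrix.of fun v e =>
    (if G.tail e = v then 1 else 0) - (if G.head e = v then 1 else 0)
  have hN : ∀ (η : D → ℚ), (∀ d, η (G.rev d) = -η d) →
      N.mulVecLin (fun e : E => η e) = G.outflow η := by
    intro η hη
    ext v
    rw [G.outflow_eq_sum_orientation hE hη v]
    rfl
  let δ : (F → ℚ) →ₗ[ℚ] (E → ℚ) :=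
    { toFun := fun φ e => φ (G.right e) - φ (G.right (G.rev e))
      map_add' := fun x y => by ext e; simp only [Pi.add_apply]; ring
      map_smul' := fun a x => by
        ext e; simp only [Pi.smul_apply, smul_eq_mul, RingHom.id_apply]; ring }
  have hle : LinearMap.range δ ≤ LinearMap.ker N.mulVecLin := by
    rintro _ ⟨φ, rfl⟩
    have hpot : G.IsPotential φ (fun d => φ (G.right d) - φ (G.right (G.rev d))) := fun d => rfl
    rw [LinearMap.mem_ker]
    refine (hN (fun d => φ (G.right d) - φ (G.right (G.rev d))) hpot.rev).trans ?_
    ext v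
    exact hpot.outflow_eq_zero v
  -- the kernel of the potential difference consists of the constants
  have hkerδ : Module.finrank ℚ (LinearMap.ker δ) ≤ 1 := by
    refine finrank_le_one ⟨fun _ => 1, ?_⟩ ?_
    · rw [LinearMap.mem_ker]
      ext e
      exact sub_self _
    · rintro ⟨φ, hφ⟩
      refine ⟨φ fInf, ?_⟩
      have hconst : ∀ d, φ (G.right d) = φ (G.right (G.rev d)) := by
        have h : ∀ d ∈ E, φ (G.right d) = φ (G.right (G.rev d)) := fun d hd =>
          sub_eq_zero.1 (congrFun (LinearMap.mem_ker.1 hφ) ⟨d, hd⟩)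
        intro d
        by_cases hd : d ∈ E
        · exact h d hd
        · have hr : G.rev d ∈ E := by rw [hE, G.rev_rev]; exact hd
          have := h _ hr
          rw [G.rev_rev] at this
          exact this.symm
      ext f
      simpa using G.eq_of_forall_right_eq hconst fInf f
  -- the kernel of the coboundary consists of the functions constant on components
  have hkerN : Module.finrank ℚ (LinearMap.ker N.transpose.mulVecLin) ≤
      Nat.card (Quot fun u v : V => ∃ d, G.tail d = u ∧ G.tail (G.rev d) = v) := by
    set C := Quot fun u v : V => ∃ d, G.tail d = u ∧ G.tail (G.rev d) = v
    have : Finite C := Quot.finite _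
    have := Fintype.ofFinite C
    have hsub : LinearMap.ker N.transpose.mulVecLin ≤
        LinearMap.range (LinearMap.funLeft ℚ ℚ (Quot.mk _ : V → C)) := by
      intro f hf
      have h : ∀ d ∈ E, f (G.tail d) = f (G.head d) := by
        intro d hd
        have h1 : (∑ v, ((if G.tail d = v then 1 else 0) -
            (if G.head d = v then 1 else 0)) * f v) = 0 :=
          congrFun (LinearMap.mem_ker.1 hf) ⟨d, hd⟩
        simpa [sub_mul, Finset.sum_sub_distrib, sub_eq_zero] using h1
      refine ⟨Quot.lift f ?_, by ext v; rfl⟩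
      rintro _ _ ⟨d, rfl, rfl⟩
      by_cases hd : d ∈ E
      · exact h d hd
      · have hr : G.rev d ∈ E := by rw [hE, G.rev_rev]; exact hd
        have := h _ hr
        rw [head, G.rev_rev] at this
        exact this.symm
    calc _ ≤ Module.finrank ℚ (LinearMap.range (LinearMap.funLeft ℚ ℚ (Quot.mk _ : V → C))) :=
          Submodule.finrank_mono hsub
      _ ≤ Module.finrank ℚ (C → ℚ) := LinearMap.finrank_range_le _
      _ = Nat.card C := by rw [Module.finrank_fintype_fun_eq_card, Nat.card_eq_fintype_card]
  have heq : LinearMap.range δ = LinearMap.ker N.mulVecLin := by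
    refine Submodule.eq_of_le_of_finrank_le hle ?_
    have h1 := LinearMap.finrank_range_add_finrank_ker δ
    have h2 := LinearMap.finrank_range_add_finrank_ker N.mulVecLin
    have h3 := LinearMap.finrank_range_add_finrank_ker N.transpose.mulVecLin
    have h4 := N.rank_transpose
    have h5 := G.euler
    simp only [Module.finrank_fintype_fun_eq_card, Fintype.card_coe] at h1 h2 h3
    unfold Matrix.rank at h4
    omega
  have hmem : (fun e : E => θ e) ∈ LinearMap.ker N.mulVecLin := by
    rw [LinearMap.mem_ker, hN θ hθ]
    ext v
    exact hout v
  rw [← heq] at hmem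
  obtain ⟨φ, hφ⟩ := hmem
  refine ⟨φ, fun d => ?_⟩
  by_cases hd : d ∈ E
  · exact (congrFun hφ ⟨d, hd⟩).symm
  · have hr : G.rev d ∈ E := by rw [hE, G.rev_rev]; exact hd
    have h : φ (G.right (G.rev d)) - φ (G.right (G.rev (G.rev d))) = θ (G.rev d) :=
      congrFun hφ ⟨_, hr⟩
    rw [hθ, G.rev_rev] at h
    linarith

/-- An integral circulation has an integral potential, normalized at a given face. -/
theorem exists_potential (fInf : F) {θ : D → ℤ} (hθ : ∀ d, θ (G.rev d) = -θ d)
    (hout : ∀ v, G.outflow θ v = 0) : ∃ φ : F → ℤ, φ fInf = 0 ∧ G.IsPotential φ θ := by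
  classical
  obtain ⟨ψ, hψ⟩ := G.exists_rat_potential fInf (θ := fun d => (θ d : ℚ))
    (fun d => by rw [hθ]; push_cast; rfl)
    (fun v => by
      have := hout v
      unfold outflow at *
      rw [← Int.cast_sum, this, Int.cast_zero])
  -- the potential changes by integers from face to face
  have hint : ∀ f, ∃ n : ℤ, ψ f - ψ fInf = n := by
    have : ∀ f, (∃ n : ℤ, ψ f - ψ fInf = n) = ∃ n : ℤ, ψ fInf - ψ fInf = n := by
      intro f
      refine G.eq_of_forall_right_eq (φ := fun f => ∃ n : ℤ, ψ f - ψ fInf = n) ?_ f fInf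
      intro d
      have h : (θ d : ℚ) = _ := hψ d
      refine propext ⟨?_, ?_⟩
      · rintro ⟨n, hn⟩
        exact ⟨n - θ d, by push_cast; linarith⟩
      · rintro ⟨n, hn⟩
        exact ⟨n + θ d, by push_cast; linarith⟩
    intro f
    rw [this]
    exact ⟨0, by simp⟩
  choose φ hφ using hint
  refine ⟨φ, ?_, fun d => ?_⟩
  · have := hφ fInf
    rw [sub_self] at this
    exact_mod_cast this.symm
  · have h : (θ d : ℚ) = _ := hψ d
    have h1 := hφ (G.right d)
    have h2 := hφ (G.right (G.rev d))
    have : (θ d : ℚ) = ((φ (G.right d) - φ (G.right (G.rev d)) : ℤ) : ℚ) := by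
      push_cast; linarith
    exact_mod_cast this

variable {G}

/-- The potential of the zero flow that vanishes at one face is zero. -/
theorem IsPotential.eq_zero {φ : F → ℤ} {fInf : F}
    (h : ∀ d, φ (G.right d) - φ (G.right (G.rev d)) = 0) (h0 : φ fInf = 0) (f : F) : φ f = 0 :=
  (G.eq_of_forall_right_eq (fun d => sub_eq_zero.1 (h d)) f fInf).trans h0

end PlaneGraph

namespace PlaneGraph

variable {V D F : Type*} [Fintype V] [Fintype D] [Fintype F] (G : PlaneGraph V D F)

/-! ### Unit flows along walks -/

open Classical in
/-- The integral version of `unitFlow`. -/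
noncomputable def flow (l : List D) (d : D) : ℤ :=
  (l.count d : ℤ) - (l.count (G.rev d) : ℤ)

theorem flow_eq_count [DecidableEq D] (l : List D) (d : D) :
    G.flow l d = (l.count d : ℤ) - (l.count (G.rev d) : ℤ) := by
  unfold flow
  congr!

theorem unitFlow_eq_flow (l : List D) (d : D) : G.unitFlow l d = (G.flow l d : ℝ) := by
  simp [unitFlow, flow]

theorem flow_rev (l : List D) (d : D) : G.flow l (G.rev d) = -G.flow l d := by
  simp [flow, G.rev_rev]

theorem flow_append (l l' : List D) (d : D) : G.flow (l ++ l') d = G.flow l d + G.flow l' d := by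
  simp only [flow, List.count_append]
  push_cast
  ring

theorem flow_map_rev_reverse (l : List D) (d : D) :
    G.flow (l.map G.rev).reverse d = -G.flow l d := by
  classical
  have hinj : Function.Injective G.rev := fun a b h => by rw [← G.rev_rev a, h, G.rev_rev]
  have h : ∀ d, (l.map G.rev).count d = l.count (G.rev d) := fun d => by
    rw [← List.count_map_of_injective l G.rev hinj, G.rev_rev]
  have h1 := h d
  have h2 := h (G.rev d)
  rw [G.rev_rev] at h2
  simp only [flow_eq_count, List.count_reverse]
  rw [h1, h2]
  ring

theorem flow_pos {l : List D} {d : D} (h : 0 < G.flow l d) : d ∈ l := by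
  classical
  by_contra hd
  have := List.count_eq_zero_of_not_mem hd
  simp only [flow_eq_count] at h
  rw [this] at h
  omega

theorem flow_eq_zero {l : List D} {d : D} (h : d ∉ l) (h' : G.rev d ∉ l) : G.flow l d = 0 := by
  classical
  simp [flow_eq_count, List.count_eq_zero_of_not_mem h, List.count_eq_zero_of_not_mem h']

theorem flow_eq_one {l : List D} {d : D} (hl : l.Nodup) (h : d ∈ l) (h' : G.rev d ∉ l) :
    G.flow l d = 1 := by
  classical
  simp [flow_eq_count, List.count_eq_zero_of_not_mem h', List.count_eq_one_of_mem hl h]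

open Classical in
/-- The unit flow along a walk from `u` to `w` has one unit of supply at `u` and one unit of demand
at `w`. -/
theorem outflow_flow {u w : V} {l : List D} (h : G.IsWalk u l w) (v : V) :
    G.outflow (G.flow l) v = (if u = v then 1 else 0) - (if w = v then 1 else 0) := by
  classical
  induction l generalizing u with
  | nil =>
    obtain rfl : u = w := h
    simp [outflow, flow]
  | cons e l ih =>
    obtain ⟨he, hl⟩ := h
    have h1 : ∀ d, G.flow (e :: l) d =
        G.flow l d + ((if d = e then 1 else 0) - (if d = G.rev e then 1 else 0)) := by
      intro d
      have : G.rev d = e ↔ d = G.rev e :=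
        ⟨fun h => by rw [← h, G.rev_rev], fun h => by rw [h, G.rev_rev]⟩
      simp only [flow, List.count_cons, beq_iff_eq, eq_comm (a := e), this]
      push_cast
      ring
    have h2 := ih hl
    unfold outflow at h2 ⊢
    rw [Finset.sum_congr rfl fun d _ => h1 d, Finset.sum_add_distrib, h2,
      Finset.sum_sub_distrib, Finset.sum_ite_eq', Finset.sum_ite_eq']
    simp only [Finset.mem_filter, Finset.mem_univ, true_and, he]
    rw [show G.tail (G.rev e) = G.head e from rfl]
    ring

theorem IsWalk.append {u v w : V} {l l' : List D} (h : G.IsWalk u l v) (h' : G.IsWalk v l' w) :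
    G.IsWalk u (l ++ l') w := by
  induction l generalizing u with
  | nil => obtain rfl : u = v := h; exact h'
  | cons e l ih => exact ⟨h.1, ih h.2⟩

theorem isWalk_append {u w : V} {l l' : List D} (h : G.IsWalk u (l ++ l') w) :
    ∃ v, G.IsWalk u l v ∧ G.IsWalk v l' w := by
  induction l generalizing u with
  | nil => exact ⟨u, rfl, h⟩
  | cons e l ih =>
    obtain ⟨v, h1, h2⟩ := ih h.2
    exact ⟨v, ⟨h.1, h1⟩, h2⟩

/-- The starting point followed by the heads, and the tails followed by the end point, are the same
list: the vertices of the walk. -/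
theorem IsWalk.vertices {u w : V} {l : List D} (h : G.IsWalk u l w) :
    u :: l.map G.head = l.map G.tail ++ [w] := by
  induction l generalizing u with
  | nil => obtain rfl : u = w := h; rfl
  | cons e l ih => simp only [List.map_cons, List.cons_append, ih h.2, h.1]

/-! ### Circulations and simple cycles -/

/-- A nonzero circulation flows around some simple cycle. -/
theorem exists_simpleCycle {θ : D → ℤ} (hθ : ∀ d, θ (G.rev d) = -θ d)
    (hout : ∀ v, G.outflow θ v = 0) (hne : ∃ d, θ d ≠ 0) :
    ∃ C, G.IsSimpleCycle C ∧ ∀ d ∈ C, 0 < θ d := by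
  classical
  let W := {v : V // ∃ d, G.tail d = v ∧ 0 < θ d}
  -- flow conservation: a dart carrying flow is followed by another one
  have hnext : ∀ d, 0 < θ d → ∃ e, G.tail e = G.head d ∧ 0 < θ e := by
    intro d hd
    by_contra! hcon
    have h0 := hout (G.head d)
    have : G.outflow θ (G.head d) < 0 := by
      refine Finset.sum_neg' (fun e he => hcon e (Finset.mem_filter.1 he).2)
        ⟨G.rev d, Finset.mem_filter.2 ⟨Finset.mem_univ _, rfl⟩, by rw [hθ]; omega⟩
    omega
  choose n hn using fun w : W => w.2
  let f : W → W := fun w => ⟨G.head (n w), hnext _ (hn w).2⟩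
  obtain ⟨w0⟩ : Nonempty W := by
    obtain ⟨d, hd⟩ := hne
    rcases lt_or_gt_of_ne hd with h | h
    · exact ⟨⟨_, G.rev d, rfl, by rw [hθ]; omega⟩⟩
    · exact ⟨⟨_, d, rfl, h⟩⟩
  obtain ⟨w, hw⟩ : ∃ w : W, w ∈ Function.periodicPts f := by
    obtain ⟨a, b, hab, h⟩ := Finite.exists_ne_map_eq_of_infinite (fun k : ℕ => f^[k] w0)
    wlog hlt : a < b generalizing a b
    · exact this b a hab.symm h.symm (by omega)
    refine ⟨f^[a] w0, Function.mk_mem_periodicPts (n := b - a) (by omega) ?_⟩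
    change f^[b - a] (f^[a] w0) = f^[a] w0
    rw [← Function.iterate_add_apply, Nat.sub_add_cancel hlt.le]
    exact h.symm
  set k := Function.minimalPeriod f w
  have hk : 0 < k := Function.minimalPeriod_pos_of_mem_periodicPts hw
  have hmem : ∀ d ∈ (List.range k).map fun i => n (f^[i] w), 0 < θ d := by
    intro d hd
    obtain ⟨i, -, rfl⟩ := List.mem_map.1 hd
    exact (hn _).2
  refine ⟨(List.range k).map fun i => n (f^[i] w), ⟨?_, ⟨w.1, ?_⟩, ?_, ?_⟩, hmem⟩
  · simpa using hk.ne'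
  · have hwalk : ∀ m, G.IsWalk w.1 ((List.range m).map fun i => n (f^[i] w)) (f^[m] w).1 := by
      intro m
      induction m with
      | zero => exact rfl
      | succ m ih =>
        rw [List.range_succ, List.map_append]
        refine ih.append _ ⟨(hn _).1, ?_⟩
        rw [Function.iterate_succ_apply']
        exact rfl
    have := hwalk k
    rwa [Function.iterate_minimalPeriod] at this
  · rw [List.map_map]
    refine List.Nodup.map_on ?_ List.nodup_range
    intro i hi j hj hij
    simp only [Function.comp_apply, (hn _).1] at hij
    exact Function.iterate_injOn_Iio_minimalPeriod (by simpa using hi) (by simpa using hj)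
      (Subtype.ext hij)
  · intro d hd hr
    have h1 := hmem d hd
    have h2 := hmem _ hr
    rw [hθ] at h2
    omega

theorem flow_le_one {l : List D} (hl : l.Nodup) (d : D) : G.flow l d ≤ 1 := by
  classical
  have h := List.nodup_iff_count_le_one.1 hl d
  simp only [flow_eq_count]
  omega

theorem outflow_sub {θ η : D → ℤ} (v : V) :
    G.outflow (fun d => θ d - η d) v = G.outflow θ v - G.outflow η v := by
  simp [outflow, Finset.sum_sub_distrib]

/-- A closed walk is a circulation. -/
theorem outflow_flow_closed {v : V} {l : List D} (h : G.IsWalk v l v) (u : V) :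
    G.outflow (G.flow l) u = 0 := by
  classical
  rw [G.outflow_flow h, sub_self]

/-- A circulation that flows only along a simple cycle is constant on that cycle. -/
theorem eq_of_mem_simpleCycle {C : List D} (hC : G.IsSimpleCycle C) {θ : D → ℤ}
    (hθ : ∀ d, θ (G.rev d) = -θ d) (hout : ∀ v, G.outflow θ v = 0)
    (hsupp : ∀ d, 0 < θ d → d ∈ C) (a b : D) (ha : a ∈ C) (hb : b ∈ C) : θ a = θ b := by
  classical
  obtain ⟨-, ⟨v, hw⟩, hnd, hrev⟩ := hC
  have hheads : (C.map G.head).Nodup := by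
    have h := hw.vertices
    have : (C.map G.head).Perm (C.map G.tail) := by
      have h2 : (v :: C.map G.head).Perm (v :: C.map G.tail) := by
        rw [h]
        exact List.perm_append_singleton _ _
      exact h2.cons_inv
    exact this.nodup_iff.2 hnd
  have htail : ∀ x ∈ C, ∀ y ∈ C, G.tail x = G.tail y → x = y := fun x hx y hy h =>
    List.inj_on_of_nodup_map hnd hx hy h
  have hhead : ∀ x ∈ C, ∀ y ∈ C, G.head x = G.head y → x = y := fun x hx y hy h =>
    List.inj_on_of_nodup_map hheads hx hy h
  -- at a vertex of the cycle, only one dart carries flow in and only one carries flow out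
  have hstep : ∀ x ∈ C, ∀ y ∈ C, G.head x = G.tail y → θ x = θ y := by
    intro x hx y hy hxy
    have h := hout (G.tail y)
    unfold outflow at h
    have hne : y ≠ G.rev x := fun h => hrev x hx (h ▸ hy)
    rw [Finset.sum_eq_add y (G.rev x) hne] at h
    · rw [hθ] at h; omega
    · intro d hd hdd
      have hdt : G.tail d = G.tail y := (Finset.mem_filter.1 hd).2
      by_contra hd0
      rcases lt_or_gt_of_ne hd0 with h1 | h1
      · have h2 : G.rev d ∈ C := hsupp _ (by rw [hθ]; omega)
        have := hhead _ h2 _ hx (by rw [head, G.rev_rev, hdt, hxy])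
        exact hdd.2 (by rw [← this, G.rev_rev])
      · exact hdd.1 (htail _ (hsupp _ h1) _ hy hdt)
    · intro h; simp at h
    · intro h; simp [head] at h hxy; exact absurd hxy h
  have hall : ∀ (l : List D) (u w : V), (∀ d ∈ l, d ∈ C) → G.IsWalk u l w →
      ∀ x ∈ l, ∀ y ∈ l.head?, θ x = θ y := by
    intro l
    induction l with
    | nil => simp
    | cons e l ih =>
      intro u w hl hlw x hx y hy
      obtain rfl : e = y := by simpa using hy
      rcases List.mem_cons.1 hx with rfl | hx
      · rfl
      · cases l with
        | nil => simp at hx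
        | cons e' l =>
          rw [ih _ _ (fun d hd => hl d (List.mem_cons_of_mem _ hd)) hlw.2 x hx e' (by simp)]
          exact (hstep _ (hl _ (by simp)) _ (hl _ (by simp)) hlw.2.1.symm).symm
  cases C with
  | nil => simp at ha
  | cons e l =>
    rw [hall _ _ _ (fun d h => h) hw a ha e (by simp),
      hall _ _ _ (fun d h => h) hw b hb e (by simp)]

/-- Truncating a potential at zero leaves, of the flow on each dart, a part in the same
direction. -/
theorem posPart_potential {φ : F → ℤ} {θ : D → ℤ} (h : G.IsPotential φ θ) (d : D)
    (hd : 0 < max (φ (G.right d)) 0 - max (φ (G.right (G.rev d))) 0) :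
    0 < θ d ∧ max (φ (G.right d)) 0 - max (φ (G.right (G.rev d))) 0 ≤ θ d := by
  have := h d
  omega

/-- The potential of a simple cycle that vanishes at one face is nonnegative or nonpositive (a weak
form of the Jordan curve theorem): the flow of its positive part is constant along the cycle, so it
is either zero or the whole cycle. -/
theorem simpleCycle_potential {C : List D} (hC : G.IsSimpleCycle C) {φ : F → ℤ} {fInf : F}
    (h0 : φ fInf = 0) (hφ : G.IsPotential φ (G.flow C)) :
    (∀ f, 0 ≤ φ f) ∨ ∀ f, φ f ≤ 0 := by
  classical
  have hnd : C.Nodup := hC.2.2.1.of_map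
  let ψ : F → ℤ := fun f => max (φ f) 0
  let η : D → ℤ := fun d => ψ (G.right d) - ψ (G.right (G.rev d))
  have hψ : G.IsPotential ψ η := fun d => rfl
  have hsupp : ∀ d, 0 < η d → d ∈ C := fun d hd => G.flow_pos (G.posPart_potential hφ d hd).1
  have hconst := G.eq_of_mem_simpleCycle hC hψ.rev hψ.outflow_eq_zero hsupp
  have hzero : ∀ d, d ∉ C → G.rev d ∉ C → η d = 0 := by
    intro d h1 h2
    by_contra hne
    rcases lt_or_gt_of_ne hne with h | h
    · exact h2 (hsupp _ (by rw [hψ.rev]; omega))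
    · exact h1 (hsupp _ h)
  obtain ⟨e, he⟩ := List.exists_mem_of_ne_nil _ hC.1
  by_cases hpos : 0 < η e
  · left
    have h1 : ∀ d ∈ C, η d = G.flow C d := by
      intro d hd
      have h2 : 0 < η d := by rw [hconst d e hd he]; exact hpos
      have h3 := (G.posPart_potential hφ d h2).2
      have h4 := G.flow_le_one hnd d
      have h5 : η d ≤ G.flow C d := h3
      omega
    have h2 : ∀ d, η d = G.flow C d := by
      intro d
      by_cases hd : d ∈ C
      · exact h1 d hd
      · by_cases hr : G.rev d ∈ C
        · have := h1 _ hr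
          rw [hψ.rev, flow_rev] at this
          omega
        · rw [hzero d hd hr, G.flow_eq_zero hd hr]
    intro f
    have h3 := IsPotential.eq_zero (G := G) (φ := fun f => ψ f - φ f) (fInf := fInf)
      (fun d => by have h4 := h2 d; rw [hφ d] at h4; simp only [η] at h4; omega)
      (by simp [ψ, h0]) f
    simp only [ψ] at h3
    omega
  · right
    have h1 : ∀ d, ¬ 0 < η d := fun d hd => hpos (by rw [hconst e d he (hsupp d hd)]; exact hd)
    intro f
    have h3 := IsPotential.eq_zero (G := G) (φ := ψ) (fInf := fInf) (fun d => by
      have h2 := h1 d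
      have h4 := h1 (G.rev d)
      rw [hψ.rev] at h4
      simp only [η] at h2 h4
      omega) (by simp [ψ, h0]) f
    simp only [ψ] at h3
    omega

/-! ### Residual circulations and the leftmost path -/

theorem isClockwise_of_potential {fInf : F} {φ : F → ℤ} {θ : D → ℤ} {l : List D}
    (h0 : φ fInf = 0) (hpos : ∀ f, 0 ≤ φ f) (hφ : G.IsPotential φ θ)
    (hl : ∀ d, G.flow l d = θ d) : G.IsClockwise fInf (G.unitFlow l) := by
  refine ⟨fun f => φ f, by simp [h0], fun f => Int.cast_nonneg (hpos f), fun d => ?_⟩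
  rw [unitFlow_eq_flow, hl, hφ]
  push_cast
  rfl

variable {G}

/-- For clockwise acyclic capacities, a residual clockwise circulation is zero. -/
theorem ClockwiseAcyclic.potential_eq_zero {fInf : F} {c : D → ℝ} (hc : G.ClockwiseAcyclic fInf c)
    (N : ℕ) : ∀ {φ : F → ℤ} {θ : D → ℤ}, (∑ d, (θ d).natAbs = N) → φ fInf = 0 →
      G.IsPotential φ θ → (∀ d, 0 < θ d → 0 < c d) → (∀ f, 0 ≤ φ f) → ∀ f, φ f = 0 := by
  classical
  induction N using Nat.strong_induction_on with
  | _ N ih =>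
    intro φ θ hN h0 hφ hres hpos
    by_cases hne : ∃ d, θ d ≠ 0
    · obtain ⟨C, hC, hCθ⟩ := G.exists_simpleCycle hφ.rev hφ.outflow_eq_zero hne
      have hnd : C.Nodup := hC.2.2.1.of_map
      have hone : ∀ d ∈ C, G.flow C d = 1 := fun d hd => G.flow_eq_one hnd hd (hC.2.2.2 d hd)
      obtain ⟨ψ, hψ0, hψ⟩ := G.exists_potential fInf (G.flow_rev C)
        (by obtain ⟨v, hv⟩ := hC.2.1; exact G.outflow_flow_closed hv)
      rcases G.simpleCycle_potential hC hψ0 hψ with h | h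
      · exact absurd (G.isClockwise_of_potential hψ0 h hψ fun d => rfl)
          (hc C hC fun d hd => hres d (hCθ d hd))
      · have hcase : ∀ d, G.flow C d = 1 ∧ 0 < θ d ∨ G.flow C d = -1 ∧ θ d < 0 ∨
            G.flow C d = 0 := by
          intro d
          by_cases hd : d ∈ C
          · exact Or.inl ⟨hone d hd, hCθ d hd⟩
          · by_cases hr : G.rev d ∈ C
            · have h1 := hone _ hr
              have h2 := hCθ _ hr
              rw [flow_rev] at h1
              rw [hφ.rev] at h2
              exact Or.inr (Or.inl (by omega))
            · exact Or.inr (Or.inr (G.flow_eq_zero hd hr))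
        have hlt : ∑ d, (θ d - G.flow C d).natAbs < N := by
          rw [← hN]
          obtain ⟨e, he⟩ := List.exists_mem_of_ne_nil _ hC.1
          refine Finset.sum_lt_sum (fun d _ => ?_) ⟨e, Finset.mem_univ _, ?_⟩
          · have := hcase d; omega
          · have h1 := hone e he
            have h2 := hCθ e he
            omega
        have hz := ih _ hlt (φ := fun f => φ f - ψ f) (θ := fun d => θ d - G.flow C d) rfl
          (by simp [h0, hψ0]) (fun d => by have h3 := hφ d; have h4 := hψ d; beta_reduce; omega)
          (fun d hd => hres d (by
            have := hcase d
            omega))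
          (fun f => by have h1 := hpos f; have h2 := h f; omega)
        intro f
        have h1 := hz f
        have h2 := h f
        have h3 := hpos f
        omega
    · push Not at hne
      exact IsPotential.eq_zero (fun d => by rw [← hφ d, hne]) h0

/-- For clockwise acyclic capacities, every residual circulation is counterclockwise: its positive
part would be a residual clockwise circulation. -/
theorem ClockwiseAcyclic.potential_nonpos {fInf : F} {c : D → ℝ} (hc : G.ClockwiseAcyclic fInf c)
    {φ : F → ℤ} {θ : D → ℤ} (h0 : φ fInf = 0) (hφ : G.IsPotential φ θ)
    (hres : ∀ d, 0 < θ d → 0 < c d) (f : F) : φ f ≤ 0 := by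
  have := hc.potential_eq_zero _ (φ := fun f => max (φ f) 0)
    (θ := fun d => max (φ (G.right d)) 0 - max (φ (G.right (G.rev d))) 0) rfl (by simp [h0])
    (fun d => rfl) (fun d hd => hres d (G.posPart_potential hφ d hd).1)
    (fun f => le_max_right _ _) f
  omega

variable (G)

open Classical in
/-- A unit flow from `s` to `t` contains a simple path from `s` to `t`. -/
theorem exists_simplePath {s t : V} {θ : D → ℤ} (hθ : ∀ d, θ (G.rev d) = -θ d)
    (hout : ∀ v, G.outflow θ v = (if s = v then 1 else 0) - (if t = v then 1 else 0)) :
    ∃ R, G.IsSimplePath s t R ∧ ∀ d ∈ R.darts, 0 < θ d := by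
  classical
  let S : Set V := {v | ∃ l, G.IsWalk s l v ∧ (s :: l.map G.head).Nodup ∧ ∀ d ∈ l, 0 < θ d}
  have hsS : s ∈ S := ⟨[], rfl, by simp, by simp⟩
  have hclosed : ∀ d, 0 < θ d → G.tail d ∈ S → G.head d ∈ S := by
    rintro d hd ⟨l, hw, hn, hl⟩
    by_cases hmem : G.head d ∈ s :: l.map G.head
    · -- cut the walk where it first reaches the vertex
      rcases List.mem_cons.1 hmem with h | h
      · rw [h]; exact hsS
      · obtain ⟨e, he, heq⟩ := List.mem_map.1 h
        obtain ⟨l1, l2, rfl⟩ := List.append_of_mem he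
        obtain ⟨v, h1, h2⟩ := G.isWalk_append hw
        refine ⟨l1 ++ [e], h1.append _ ⟨h2.1, heq⟩, ?_, fun x hx => hl x (by simp at hx ⊢; tauto)⟩
        refine hn.sublist ?_
        have : l1 ++ e :: l2 = (l1 ++ [e]) ++ l2 := by simp
        rw [this, List.map_append (l₂ := l2)]
        exact (List.sublist_append_left _ _).cons_cons _
    · refine ⟨l ++ [d], hw.append _ ⟨rfl, rfl⟩, ?_, ?_⟩
      · have : s :: (l ++ [d]).map G.head = (s :: l.map G.head) ++ [G.head d] := by simp
        rw [this]
        exact List.nodup_append.2 ⟨hn, by simp, by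
          intro a ha b hb; simp only [List.mem_singleton] at hb; rintro rfl; exact hmem (hb ▸ ha)⟩
      · intro x hx
        rcases List.mem_append.1 hx with h | h
        · exact hl x h
        · rw [List.mem_singleton.1 h]; exact hd
  have htS : t ∈ S := by
    by_contra htS
    -- the total outflow of the vertices reachable from `s` is both positive and nonpositive
    have h1 : ∑ v with v ∈ S, G.outflow θ v = 1 := by
      rw [Finset.sum_congr rfl fun v _ => hout v, Finset.sum_sub_distrib, Finset.sum_ite_eq,
        Finset.sum_ite_eq]
      simp [hsS, htS]
    have h2 : ∑ v with v ∈ S, G.outflow θ v = ∑ d with G.tail d ∈ S, θ d := by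
      unfold outflow
      rw [← Finset.sum_biUnion]
      · refine Finset.sum_congr ?_ fun _ _ => rfl
        ext d; simp
      · intro a _ b _ hab
        refine Finset.disjoint_left.2 fun d hd hd' => hab ?_
        rw [← (Finset.mem_filter.1 hd).2, ← (Finset.mem_filter.1 hd').2]
    have h3 : ∑ d with G.tail d ∈ S ∧ G.head d ∈ S, θ d = 0 := by
      have : ∑ d with G.tail d ∈ S ∧ G.head d ∈ S, θ d =
          ∑ d with G.tail d ∈ S ∧ G.head d ∈ S, -θ d := by
        refine Finset.sum_nbij' G.rev G.rev ?_ ?_ ?_ ?_ ?_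
        · intro d hd
          rw [Finset.mem_filter] at hd ⊢
          simp only [Finset.mem_univ, true_and, head, G.rev_rev] at hd ⊢
          exact And.symm hd
        · intro d hd
          rw [Finset.mem_filter] at hd ⊢
          simp only [Finset.mem_univ, true_and, head, G.rev_rev] at hd ⊢
          exact And.symm hd
        · intro d _; exact G.rev_rev d
        · intro d _; exact G.rev_rev d
        · intro d _; rw [hθ, neg_neg]
      rw [Finset.sum_neg_distrib] at this
      omega
    have h4 : ∑ d with G.tail d ∈ S, θ d =
        ∑ d with G.tail d ∈ S ∧ G.head d ∈ S, θ d + ∑ d with G.tail d ∈ S ∧ G.head d ∉ S, θ d := by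
      rw [← Finset.sum_filter_add_sum_filter_not _ (fun d => G.head d ∈ S), Finset.filter_filter,
        Finset.filter_filter]
    have h5 : ∑ d with G.tail d ∈ S ∧ G.head d ∉ S, θ d ≤ 0 := by
      refine Finset.sum_nonpos fun d hd => ?_
      obtain ⟨h6, h7⟩ := (Finset.mem_filter.1 hd).2
      by_contra hcon
      exact h7 (hclosed d (by omega) h6)
    omega
  obtain ⟨l, hw, hn, hl⟩ := htS
  exact ⟨⟨s, l⟩, ⟨rfl, hw, hn⟩, hl⟩

theorem IsSimplePath.nodup_darts {s t : V} {P : DartPath V D} (h : G.IsSimplePath s t P) :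
    P.darts.Nodup :=
  (List.nodup_cons.1 h.2.2).2.of_map

variable {G}

/-- Among all residual unit flows from `s` to `t`, the leftmost path has the greatest potential. -/
theorem IsLeftmostResidual.potential_nonpos {fInf : F} {c : D → ℝ}
    (hc : G.ClockwiseAcyclic fInf c) {s t : V} {P : DartPath V D}
    (hP : G.IsLeftmostResidual fInf c s t P) {φ : F → ℤ} {θ : D → ℤ} (h0 : φ fInf = 0)
    (hφ : G.IsPotential φ θ) (hres : ∀ d, 0 < G.flow P.darts d + θ d → 0 < c d) (f : F) :
    φ f ≤ 0 := by
  classical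
  obtain ⟨hPs, hPres, hleft⟩ := hP
  let ψ : F → ℤ := fun f => max (φ f) 0
  let η : D → ℤ := fun d => ψ (G.right d) - ψ (G.right (G.rev d))
  have hψ : G.IsPotential ψ η := fun d => rfl
  let A : D → ℤ := fun d => G.flow P.darts d + η d
  have hA : ∀ d, A (G.rev d) = -A d := fun d => by
    simp only [A, flow_rev, hψ.rev]; ring
  have hAres : ∀ d, 0 < A d → 0 < c d := by
    intro d hd
    by_cases hP : d ∈ P.darts
    · exact hPres d hP
    · have h1 : ¬ 0 < G.flow P.darts d := fun h => hP (G.flow_pos h)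
      have h2 : 0 < η d := by simp only [A] at hd; omega
      have h3 : η d ≤ θ d := (G.posPart_potential hφ d h2).2
      refine hres d ?_
      simp only [A] at hd; omega
  have hAout : ∀ v, G.outflow A v = (if s = v then 1 else 0) - (if t = v then 1 else 0) := by
    intro v
    rw [← G.outflow_flow hPs.2.1 v]
    have := hψ.outflow_eq_zero v
    unfold outflow at *
    rw [Finset.sum_add_distrib, this, add_zero]
  obtain ⟨R, hR, hRA⟩ := G.exists_simplePath hA hAout
  -- the rest of the flow is a residual circulation
  obtain ⟨ρ, hρ0, hρ⟩ := G.exists_potential fInf (θ := fun d => A d - G.flow R.darts d)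
    (fun d => by simp only [hA, flow_rev]; ring)
    (fun v => by rw [G.outflow_sub, hAout, G.outflow_flow hR.2.1, sub_self])
  have hρneg := hc.potential_nonpos hρ0 hρ (fun d hd => hAres d (by
    by_cases hd' : d ∈ R.darts
    · exact hRA d hd'
    · by_cases hr : G.rev d ∈ R.darts
      · have h1 := hRA _ hr
        have h2 := G.flow_eq_one hR.nodup_darts hr (by rw [G.rev_rev]; exact hd')
        rw [flow_rev] at h2
        rw [hA] at h1
        omega
      · rw [G.flow_eq_zero hd' hr] at hd
        omega))
  have hpot : G.IsPotential (fun f => ψ f - ρ f)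
      (fun d => G.flow R.darts d - G.flow P.darts d) := by
    intro d
    have h1 := hρ d
    have h2 := hψ d
    simp only [A] at h1
    simp only
    omega
  have hψpos : ∀ f, 0 ≤ ψ f := fun f => le_max_right _ _
  have hRP : R = P := by
    by_contra hne
    refine hleft R hR (fun d hd => hAres d (hRA d hd)) hne ?_
    refine G.isClockwise_of_potential (by simp [ψ, h0, hρ0])
      (fun f => by have h1 := hψpos f; have h2 := hρneg f; omega) hpot (fun d => ?_)
    rw [flow_append, revPath, flow_map_rev_reverse]
    ring
  have h1 := IsPotential.eq_zero (G := G) (φ := fun f => ψ f - ρ f) (fInf := fInf)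
    (fun d => by have h2 := hpot d; simp only [hRP, sub_self] at h2; exact h2.symm)
    (by simp [ψ, h0, hρ0]) f
  have h2 := hρneg f
  simp only [ψ] at h1
  omega

end PlaneGraph

namespace PlaneGraph

variable {V D F : Type*} [Fintype V] [Fintype D] [Fintype F] (G : PlaneGraph V D F)

/-! ### The clockwise order around a vertex -/

theorem tail_iterate_rot (n : ℕ) (d : D) : G.tail (G.rot^[n] d) = G.tail d := by
  induction n with
  | zero => rfl
  | succ n ih => rw [Function.iterate_succ_apply', tail_rot, ih]

theorem mem_periodicPts_rot (x : D) : x ∈ Function.periodicPts G.rot :=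
  Function.Injective.mem_periodicPts G.rot.injective x

theorem exists_iterate_rot {x y : D} (h : G.tail x = G.tail y) :
    ∃ i < Function.minimalPeriod G.rot x, G.rot^[i] x = y := by
  obtain ⟨n, hn⟩ := ((G.rot_sameCycle x y).2 h).exists_nat_pow_eq
  refine ⟨n % Function.minimalPeriod G.rot x, Nat.mod_lt _
    (Function.minimalPeriod_pos_of_mem_periodicPts (G.mem_periodicPts_rot x)), ?_⟩
  rw [Function.iterate_mod_minimalPeriod_eq, Equiv.Perm.iterate_eq_pow, hn]

theorem cwOrder_iterate_zero (x : D) {j k : ℕ} (hj : j < Function.minimalPeriod G.rot x)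
    (hk : k < Function.minimalPeriod G.rot x) (hk0 : 0 < k) :
    G.CwOrder x (G.rot^[j] x) (G.rot^[k] x) ↔ 0 < j ∧ j < k := by
  have hinj := fun {a b : ℕ} (ha : a < Function.minimalPeriod G.rot x)
    (hb : b < Function.minimalPeriod G.rot x) =>
      Function.iterate_eq_iterate_iff_of_lt_minimalPeriod (f := G.rot) (x := x) ha hb
  constructor
  · rintro ⟨n, hn, h⟩
    have h1 : n + 1 < k := by
      by_contra hcon
      refine h (k - 1) (by omega) ?_
      rw [Nat.sub_add_cancel hk0]
    have := (hinj (by omega) hj).1 hn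
    omega
  · rintro ⟨h0, hjk⟩
    refine ⟨j - 1, by rw [Nat.sub_add_cancel h0], fun m hm heq => ?_⟩
    have := (hinj (by omega) hk).1 heq
    omega

/-- The clockwise order of darts that are numbered clockwise from a given dart. -/
theorem cwOrder_iterate (x : D) {i j k : ℕ} (hi : i < Function.minimalPeriod G.rot x)
    (hj : j < Function.minimalPeriod G.rot x) (hk : k < Function.minimalPeriod G.rot x)
    (hik : i ≠ k) :
    G.CwOrder (G.rot^[i] x) (G.rot^[j] x) (G.rot^[k] x) ↔
      i < j ∧ j < k ∨ j < k ∧ k < i ∨ k < i ∧ i < j := by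
  have hN := Function.minimalPeriod_apply_iterate (G.mem_periodicPts_rot x) i
  -- the number of a dart counted from `G.rot^[i] x` instead of `x`
  have hshift : ∀ m < Function.minimalPeriod G.rot x, ∃ m' < Function.minimalPeriod G.rot x,
      G.rot^[m'] (G.rot^[i] x) = G.rot^[m] x ∧
        (i ≤ m ∧ m' = m - i ∨ m < i ∧ m' = m + Function.minimalPeriod G.rot x - i) := by
    intro m hm
    by_cases h : i ≤ m
    · refine ⟨m - i, by omega, ?_, Or.inl ⟨h, rfl⟩⟩
      rw [← Function.iterate_add_apply, Nat.sub_add_cancel h]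
    · refine ⟨m + Function.minimalPeriod G.rot x - i, by omega, ?_, Or.inr ⟨by omega, rfl⟩⟩
      rw [← Function.iterate_add_apply, Nat.sub_add_cancel (by omega),
        Function.iterate_add_minimalPeriod_eq]
  obtain ⟨j', hj', ej, cj⟩ := hshift j hj
  obtain ⟨k', hk', ek, ck⟩ := hshift k hk
  rw [← ej, ← ek, G.cwOrder_iterate_zero _ (by rw [hN]; exact hj') (by rw [hN]; exact hk')
    (by omega)]
  omega

variable {G}

theorem CwOrder.tail_eq {x y z : D} (h : G.CwOrder x y z) : G.tail x = G.tail y := by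
  obtain ⟨n, rfl, -⟩ := h
  rw [tail_iterate_rot]

theorem CwOrder.ne_right {x y z : D} (h : G.CwOrder x y z) : y ≠ z := by
  obtain ⟨n, h1, h2⟩ := h
  exact h1 ▸ h2 n le_rfl

theorem CwOrder.ne_left {x y z : D} (h : G.CwOrder x y z) (hz : G.tail x = G.tail z) : x ≠ y := by
  rintro rfl
  obtain ⟨k, hk, rfl⟩ := G.exists_iterate_rot hz
  have hne := h.ne_right
  have hk0 : 0 < k := by
    rcases Nat.eq_zero_or_pos k with rfl | h0
    · exact absurd rfl hne
    · exact h0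
  have := (G.cwOrder_iterate_zero x (j := 0) (by omega) hk hk0).1 h
  omega

/-- Of three distinct darts at a vertex, exactly one of the two cyclic orders holds. -/
theorem not_cwOrder_iff {x y z : D} (hy : G.tail x = G.tail y) (hz : G.tail x = G.tail z)
    (hxy : x ≠ y) (hyz : y ≠ z) (hxz : x ≠ z) : ¬ G.CwOrder x y z ↔ G.CwOrder z y x := by
  obtain ⟨j, hj, rfl⟩ := G.exists_iterate_rot hy
  obtain ⟨k, hk, rfl⟩ := G.exists_iterate_rot hz
  have h0 : 0 < j := Nat.pos_of_ne_zero (by rintro rfl; exact hxy rfl)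
  have h1 : 0 < k := Nat.pos_of_ne_zero (by rintro rfl; exact hxz rfl)
  have h2 : j ≠ k := by rintro rfl; exact hyz rfl
  have e := G.cwOrder_iterate x (i := k) (j := j) (k := 0) hk hj (by omega) (by omega)
  rw [G.cwOrder_iterate_zero x hj hk h1]
  rw [Function.iterate_zero_apply] at e
  rw [e]
  omega

theorem CwOrder.not_reverse {x y z : D} (h : G.CwOrder x y z) (hz : G.tail x = G.tail z)
    (hxz : x ≠ z) : ¬ G.CwOrder z y x := fun h' =>
  (not_cwOrder_iff h.tail_eq hz (h.ne_left hz) h.ne_right hxz).2 h' h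

theorem cwOrder_rotate {x y z : D} (hy : G.tail x = G.tail y) (hz : G.tail x = G.tail z)
    (hxy : x ≠ y) (hxz : x ≠ z) : G.CwOrder x y z ↔ G.CwOrder y z x := by
  obtain ⟨j, hj, rfl⟩ := G.exists_iterate_rot hy
  obtain ⟨k, hk, rfl⟩ := G.exists_iterate_rot hz
  have h0 : 0 < j := Nat.pos_of_ne_zero (by rintro rfl; exact hxy rfl)
  have h1 : 0 < k := Nat.pos_of_ne_zero (by rintro rfl; exact hxz rfl)
  have e := G.cwOrder_iterate x (i := j) (j := k) (k := 0) hj hk (by omega) (by omega)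
  rw [G.cwOrder_iterate_zero x hj hk h1]
  rw [Function.iterate_zero_apply] at e
  rw [e]
  omega

/-- Four darts at a vertex: if `y` and `w` lie on different sides of `x`, `z`, then `x` and `z` lie
on different sides of `y`, `w`. -/
theorem cwOrder_interlace {x y z w : D} (hy : G.tail x = G.tail y) (hz : G.tail x = G.tail z)
    (hw : G.tail x = G.tail w) (hxz : x ≠ z) (h1 : G.CwOrder x y z) (h2 : G.CwOrder z w x) :
    G.CwOrder y z w ∧ G.CwOrder w x y := by
  have hxy := h1.ne_left hz
  have hyz := h1.ne_right
  have hwx := h2.ne_right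
  have hzw := h2.ne_left hz.symm
  obtain ⟨j, hj, rfl⟩ := G.exists_iterate_rot hy
  obtain ⟨k, hk, rfl⟩ := G.exists_iterate_rot hz
  obtain ⟨l, hl, rfl⟩ := G.exists_iterate_rot hw
  have h0 : 0 < j := Nat.pos_of_ne_zero (by rintro rfl; exact hxy rfl)
  have h0' : 0 < k := Nat.pos_of_ne_zero (by rintro rfl; exact hxz rfl)
  have h0'' : 0 < l := Nat.pos_of_ne_zero (by rintro rfl; exact hwx rfl)
  rw [G.cwOrder_iterate_zero x hj hk h0'] at h1
  have e1 := G.cwOrder_iterate x (i := k) (j := l) (k := 0) hk hl (by omega) (by omega)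
  rw [Function.iterate_zero_apply] at e1
  rw [e1] at h2
  have e2 := G.cwOrder_iterate x (i := l) (j := 0) (k := j) hl (by omega) hj (by omega)
  rw [Function.iterate_zero_apply] at e2
  rw [G.cwOrder_iterate x hj hk hl (by omega), e2]
  omega

open Classical in
/-- Turning clockwise around a vertex from the dart `x` to the dart `z`, the potential changes by
the flow on the darts strictly in between. -/
theorem IsPotential.sub_eq_sum_cwOrder {φ : F → ℤ} {θ : D → ℤ} (h : G.IsPotential φ θ) {x z : D}
    (hz : G.tail x = G.tail z) (hxz : x ≠ z) :
    φ (G.right (G.rev z)) - φ (G.right x) = ∑ d with G.CwOrder x d z, θ d := by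
  obtain ⟨k, hk, rfl⟩ := G.exists_iterate_rot hz
  obtain ⟨k, rfl⟩ : ∃ k', k = k' + 1 :=
    Nat.exists_eq_succ_of_ne_zero (by rintro rfl; exact hxz rfl)
  have hset : Finset.univ.filter (fun d => G.CwOrder x d (G.rot^[k + 1] x)) =
      (Finset.range k).image fun i => G.rot^[i + 1] x := by
    ext d
    simp only [Finset.mem_filter, Finset.mem_univ, true_and, Finset.mem_image, Finset.mem_range]
    constructor
    · intro hd
      obtain ⟨j, hj, rfl⟩ := G.exists_iterate_rot hd.tail_eq
      rw [G.cwOrder_iterate_zero x hj hk (by omega)] at hd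
      exact ⟨j - 1, by omega, by rw [Nat.sub_add_cancel hd.1]⟩
    · rintro ⟨j, hj, rfl⟩
      rw [G.cwOrder_iterate_zero x (by omega) hk (by omega)]
      omega
  rw [hset, Finset.sum_image]
  · have : ∀ i ∈ Finset.range k, θ (G.rot^[i + 1] x) =
        φ (G.right (G.rot^[i + 1] x)) - φ (G.right (G.rot^[i] x)) := by
      intro i _
      rw [h, Function.iterate_succ_apply', G.right_corner]
    rw [Finset.sum_congr rfl this, Finset.sum_range_sub (fun i => φ (G.right (G.rot^[i] x))),
      Function.iterate_succ_apply', G.right_corner]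
    rfl
  · intro a ha b hb hab
    simp only [Finset.coe_range, Set.mem_Iio] at ha hb
    have := (Function.iterate_eq_iterate_iff_of_lt_minimalPeriod (f := G.rot) (x := x)
      (m := a + 1) (n := b + 1) (by omega) (by omega)).1 hab
    omega

/-- Around a vertex that the flow does not touch, the potential is constant. -/
theorem IsPotential.eq_of_tail_eq {φ : F → ℤ} {θ : D → ℤ} (h : G.IsPotential φ θ) {x z : D}
    (hz : G.tail x = G.tail z) (h0 : ∀ d, G.tail d = G.tail x → θ d = 0) :
    φ (G.right x) = φ (G.right z) := by
  obtain ⟨k, -, rfl⟩ := G.exists_iterate_rot hz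
  induction k with
  | zero => rfl
  | succ k ih =>
    have h1 := h0 (G.rot^[k + 1] x) (G.tail_iterate_rot _ _)
    rw [h, Function.iterate_succ_apply', G.right_corner] at h1
    rw [ih (G.tail_iterate_rot _ _).symm, Function.iterate_succ_apply']
    omega

end PlaneGraph

namespace PlaneGraph

/-! ### Indexing simple paths -/

section

variable {V D : Type*}

/-- `d` is the dart number `k` of the path; it leads from vertex `k` to vertex `k + 1`. -/
def DartAt (P : DartPath V D) (k : ℕ) (d : D) : Prop := P.darts[k]? = some d

theorem DartAt.lt {P : DartPath V D} {k : ℕ} {d : D} (h : DartAt P k d) : k < P.darts.length :=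
  (List.getElem?_eq_some_iff.1 h).1

theorem DartAt.mem {P : DartPath V D} {k : ℕ} {d : D} (h : DartAt P k d) : d ∈ P.darts :=
  List.mem_of_getElem? h

theorem DartAt.eq {P : DartPath V D} {k : ℕ} {d e : D} (h : DartAt P k d) (h' : DartAt P k e) :
    d = e :=
  Option.some_injective _ (h.symm.trans h')

theorem exists_dartAt {P : DartPath V D} {k : ℕ} (h : k < P.darts.length) : ∃ d, DartAt P k d :=
  ⟨_, List.getElem?_eq_getElem h⟩

theorem exists_dartAt_of_mem {P : DartPath V D} {d : D} (h : d ∈ P.darts) : ∃ k, DartAt P k d :=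
  List.mem_iff_getElem?.1 h

theorem dartPath_ext {X Y : DartPath V D} (h : X.start = Y.start)
    (h' : ∀ k d, DartAt X k d ↔ DartAt Y k d) : X = Y :=
  DartPath.ext h (List.ext_getElem? fun k => Option.ext fun d => h' k d)

theorem pair_infix_iff {P : DartPath V D} {a b : D} :
    [a, b] <:+: P.darts ↔ ∃ k, DartAt P k a ∧ DartAt P (k + 1) b := by
  constructor
  · rintro ⟨l, l', h⟩
    refine ⟨l.length, ?_, ?_⟩ <;> simp [DartAt, ← h]
  · rintro ⟨k, ha, hb⟩
    have h1 := ha.lt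
    have h2 := hb.lt
    have h3 := (List.getElem?_eq_some_iff.1 ha).2
    have h4 := (List.getElem?_eq_some_iff.1 hb).2
    refine ⟨P.darts.take k, P.darts.drop (k + 2), ?_⟩
    conv_rhs => rw [← List.take_append_drop k P.darts, List.drop_eq_getElem_cons h1,
      List.drop_eq_getElem_cons h2, h3, h4]
    simp

end

variable {V D F : Type*} [Fintype V] [Fintype D] [Fintype F] (G : PlaneGraph V D F)

/-- The `k`-th vertex of a path (the last one if `k` is too large). -/
def vtx (P : DartPath V D) (k : ℕ) : V := G.finish ⟨P.start, P.darts.take k⟩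

theorem vtx_zero (P : DartPath V D) : G.vtx P 0 = P.start := by
  simp [vtx, finish]

variable {G}

theorem DartAt.head {P : DartPath V D} {k : ℕ} {d : D} (h : DartAt P k d) :
    G.head d = G.vtx P (k + 1) := by
  have h1 := h.lt
  unfold vtx finish
  rw [List.take_add_one, show P.darts[k]? = some d from h]
  simp

theorem finish_cons (u : V) (e : D) (l : List D) : G.finish ⟨u, e :: l⟩ = G.finish ⟨G.head e, l⟩ :=
  List.getLastD_cons

theorem IsWalk.tail_eq {u w : V} {l : List D} (h : G.IsWalk u l w) {k : ℕ} {d : D}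
    (hd : l[k]? = some d) : G.tail d = G.finish ⟨u, l.take k⟩ := by
  induction l generalizing u k with
  | nil => simp at hd
  | cons e l ih =>
    cases k with
    | zero =>
      obtain rfl : e = d := by simpa using hd
      simp [finish, h.1]
    | succ k =>
      rw [ih h.2 (by simpa using hd), List.take_succ_cons, finish_cons]

theorem IsWalk.finish_eq {u w : V} {l : List D} (h : G.IsWalk u l w) : G.finish ⟨u, l⟩ = w := by
  induction l generalizing u with
  | nil => exact h
  | cons e l ih =>
    rw [finish_cons, ih h.2]

theorem finish_eq_vtx (P : DartPath V D) : G.finish P = G.vtx P P.darts.length := by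
  simp [vtx]

theorem support_getElem? (P : DartPath V D) {k : ℕ} (h : k ≤ P.darts.length) :
    (G.support P)[k]? = some (G.vtx P k) := by
  cases k with
  | zero => simp [support, vtx_zero]
  | succ k =>
    obtain ⟨d, hd⟩ := exists_dartAt h
    rw [← hd.head]
    have : P.darts[k]? = some d := hd
    simp [support, this]

namespace IsSimplePath

variable {s t : V} {P : DartPath V D}

theorem tail (hP : G.IsSimplePath s t P) {k : ℕ} {d : D} (h : DartAt P k d) :
    G.tail d = G.vtx P k := by
  obtain ⟨rfl, hw, -⟩ := hP
  exact hw.tail_eq h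

theorem inj (hP : G.IsSimplePath s t P) {a b : ℕ} (ha : a ≤ P.darts.length)
    (hb : b ≤ P.darts.length) (h : G.vtx P a = G.vtx P b) : a = b := by
  refine (List.getElem?_inj ?_ hP.2.2).1 ?_
  · simp [support]; omega
  · rw [support_getElem? P ha, support_getElem? P hb, h]

theorem vtx_zero_eq (hP : G.IsSimplePath s t P) : G.vtx P 0 = s :=
  (G.vtx_zero P).trans hP.1

theorem vtx_length (hP : G.IsSimplePath s t P) : G.vtx P P.darts.length = t := by
  obtain ⟨rfl, hw, -⟩ := hP
  rw [← finish_eq_vtx]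
  exact hw.finish_eq

theorem index_of_tail (hP : G.IsSimplePath s t P) {k j : ℕ} {d : D} (h : DartAt P k d)
    (hj : j ≤ P.darts.length) (hd : G.tail d = G.vtx P j) : k = j :=
  hP.inj h.lt.le hj ((hP.tail h).symm.trans hd)

theorem index_of_head (hP : G.IsSimplePath s t P) {k j : ℕ} {d : D} (h : DartAt P k d)
    (hj : j ≤ P.darts.length) (hd : G.head d = G.vtx P j) : k + 1 = j :=
  hP.inj h.lt hj (h.head.symm.trans hd)

theorem rev_not_mem (hP : G.IsSimplePath s t P) {d : D} (h : d ∈ P.darts) :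
    G.rev d ∉ P.darts := by
  intro h'
  obtain ⟨k, hk⟩ := exists_dartAt_of_mem h
  obtain ⟨j, hj⟩ := exists_dartAt_of_mem h'
  have h1 := hP.index_of_tail hj hk.lt hk.head
  have h2 := hP.index_of_head hj hk.lt.le (by rw [PlaneGraph.head, G.rev_rev, hP.tail hk])
  omega

end IsSimplePath

/-! ### Subpaths -/

theorem subpath_start (P : DartPath V D) (i j : ℕ) : (G.subpath P i j).start = G.vtx P i := rfl

theorem dartAt_subpath {P : DartPath V D} {i j k : ℕ} {d : D} :
    DartAt (G.subpath P i j) k d ↔ i + k < j ∧ DartAt P (i + k) d := by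
  unfold DartAt subpath
  simp only [List.getElem?_drop, List.getElem?_take]
  split_ifs <;> simp_all

theorem length_subpath {P : DartPath V D} {i j : ℕ} (hj : j ≤ P.darts.length) :
    (G.subpath P i j).darts.length = j - i := by
  simp [subpath, hj]

theorem vtx_subpath {P : DartPath V D} {i j k : ℕ} (hj : j ≤ P.darts.length) (hk : i + k ≤ j) :
    G.vtx (G.subpath P i j) k = G.vtx P (i + k) := by
  cases k with
  | zero => rw [vtx_zero]; rfl
  | succ k =>
    obtain ⟨d, hd⟩ := exists_dartAt (P := P) (k := i + k) (by omega)
    rw [← (dartAt_subpath.2 ⟨by omega, hd⟩ : DartAt (G.subpath P i j) k d).head (G := G), hd.head]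
    rfl

theorem finish_subpath {P : DartPath V D} {i j : ℕ} (hij : i ≤ j) (hj : j ≤ P.darts.length) :
    G.finish (G.subpath P i j) = G.vtx P j := by
  rw [finish_eq_vtx, length_subpath hj, vtx_subpath hj (by omega), Nat.add_sub_cancel' hij]

theorem subpath_subpath {P : DartPath V D} {i j a b : ℕ} (hj : j ≤ P.darts.length)
    (hab : a ≤ b) (hb : i + b ≤ j) :
    G.subpath (G.subpath P i j) a b = G.subpath P (i + a) (i + b) := by
  refine dartPath_ext ?_ fun k d => ?_
  · rw [subpath_start, subpath_start, vtx_subpath hj (by omega)]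
  · simp only [dartAt_subpath, Nat.add_assoc]
    constructor
    · rintro ⟨h1, h2, h3⟩; exact ⟨by omega, h3⟩
    · rintro ⟨h1, h2⟩; exact ⟨by omega, by omega, h2⟩

theorem isSubpath_iff {X P : DartPath V D} :
    G.IsSubpath X P ↔ ∃ i L, i + L ≤ P.darts.length ∧ X = G.subpath P i (i + L) := by
  constructor
  · rintro ⟨i, j, h1, h2, rfl⟩
    exact ⟨i, j - i, by omega, by rw [Nat.add_sub_cancel' h1]⟩
  · rintro ⟨i, L, h, rfl⟩
    exact ⟨i, i + L, by omega, h, rfl⟩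

theorem IsSimplePath.subpath_inj {s t : V} {P : DartPath V D} (hP : G.IsSimplePath s t P)
    {i L j M : ℕ} (hi : i + L ≤ P.darts.length) (hj : j + M ≤ P.darts.length)
    (h : G.subpath P i (i + L) = G.subpath P j (j + M)) : i = j ∧ L = M := by
  have h1 : G.vtx P i = G.vtx P j := congrArg DartPath.start h
  have h2 := congrArg (fun X : DartPath V D => X.darts.length) h
  simp only [length_subpath hi, length_subpath hj] at h2
  exact ⟨hP.inj (by omega) (by omega) h1, by omega⟩

theorem dartAt_revPath {X : DartPath V D} {k : ℕ} {d : D} :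
    DartAt (G.revPath X) k d ↔
      k < X.darts.length ∧ DartAt X (X.darts.length - 1 - k) (G.rev d) := by
  have hrev : ∀ e, G.rev e = d ↔ e = G.rev d := fun e =>
    ⟨fun h => by rw [← h, G.rev_rev], fun h => by rw [h, G.rev_rev]⟩
  unfold DartAt revPath
  by_cases hk : k < X.darts.length
  · rw [List.getElem?_reverse (by simpa using hk)]
    simp [hk, hrev]
  · rw [List.getElem?_eq_none (by simpa using hk)]
    simp [hk]

theorem revPath_revPath {s t : V} {P : DartPath V D} (hP : G.IsSimplePath s t P) {i j : ℕ}
    (hij : i ≤ j) (hj : j ≤ P.darts.length) :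
    G.revPath (G.revPath (G.subpath P i j)) = G.subpath P i j := by
  have hlen : (G.revPath (G.subpath P i j)).darts.length = j - i := by
    simp [revPath, length_subpath hj]
  refine dartPath_ext ?_ fun k d => ?_
  · change G.finish (G.revPath (G.subpath P i j)) = _
    rw [finish_eq_vtx, hlen]
    rcases Nat.eq_or_lt_of_le hij with rfl | h
    · rw [Nat.sub_self, vtx_zero]
      exact finish_subpath hij hj
    · obtain ⟨d, hd⟩ := exists_dartAt (P := P) (k := i) (by omega)
      have h1 : DartAt (G.revPath (G.subpath P i j)) (j - i - 1) (G.rev d) := by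
        rw [dartAt_revPath, length_subpath hj, G.rev_rev, dartAt_subpath]
        refine ⟨by omega, by omega, ?_⟩
        rwa [show i + (j - i - 1 - (j - i - 1)) = i by omega]
      have h2 := h1.head (G := G)
      rw [Nat.sub_add_cancel (by omega)] at h2
      rw [← h2, PlaneGraph.head, G.rev_rev, hP.tail hd]
      rfl
  · rw [dartAt_revPath, dartAt_revPath, G.rev_rev, hlen, length_subpath hj]
    constructor
    · rintro ⟨h1, h2, h3⟩
      rwa [show j - i - 1 - (j - i - 1 - k) = k by omega] at h3
    · intro h
      have := (dartAt_subpath.1 h).1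
      refine ⟨by omega, by omega, ?_⟩
      rwa [show j - i - 1 - (j - i - 1 - k) = k by omega]

end PlaneGraph

namespace PlaneGraph

variable {V D F : Type*} [Fintype V] [Fintype D] [Fintype F] (G : PlaneGraph V D F)

/-! ### Maximal shared subpaths -/

/-- The `L` darts of `Q` from vertex `i` on are the `L` darts of `P` from vertex `A` on. -/
def Parallel (P Q : DartPath V D) (i A L : ℕ) : Prop :=
  i + L ≤ Q.darts.length ∧ A + L ≤ P.darts.length ∧ G.vtx P A = G.vtx Q i ∧
    ∀ r < L, ∀ d, DartAt Q (i + r) d → DartAt P (A + r) d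

/-- The `L` darts of `Q` from vertex `i` on are the reversals of the `L` darts of `P` from vertex
`A` on, in the opposite order. -/
def Antiparallel (P Q : DartPath V D) (i A L : ℕ) : Prop :=
  i + L ≤ Q.darts.length ∧ A + L ≤ P.darts.length ∧ G.vtx P A = G.vtx Q (i + L) ∧
    ∀ r < L, ∀ d, DartAt Q (i + r) d → DartAt P (A + (L - 1 - r)) (G.rev d)

/-- The `L` darts of `Q` from vertex `i` on and the `L` darts of `P` from vertex `A` on form, up to
direction, the same path, and `Q` does not share the edge before or the edge after it with `P`. -/
structure IsComponent (P Q : DartPath V D) (i A L : ℕ) : Prop where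
  run : G.Parallel P Q i A L ∨ G.Antiparallel P Q i A L
  before : ∀ k d, k + 1 = i → DartAt Q k d → d ∉ P.darts ∧ G.rev d ∉ P.darts
  after : ∀ d, DartAt Q (i + L) d → d ∉ P.darts ∧ G.rev d ∉ P.darts

variable {G} {s t : V} {P Q : DartPath V D} {i A L : ℕ}

theorem Parallel.vtx_eq (h : G.Parallel P Q i A L) {r : ℕ} (hr : r ≤ L) :
    G.vtx P (A + r) = G.vtx Q (i + r) := by
  obtain ⟨h1, h2, h3, h4⟩ := h
  cases r with
  | zero => exact h3
  | succ r =>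
    obtain ⟨d, hd⟩ := exists_dartAt (P := Q) (k := i + r) (by omega)
    have h5 := (h4 r (by omega) d hd).head (G := G)
    rw [hd.head] at h5
    exact h5.symm

theorem Antiparallel.vtx_eq (h : G.Antiparallel P Q i A L) (hQ : G.IsSimplePath s t Q) {r : ℕ}
    (hr : r ≤ L) : G.vtx P (A + (L - r)) = G.vtx Q (i + r) := by
  obtain ⟨h1, h2, h3, h4⟩ := h
  rcases Nat.eq_or_lt_of_le hr with rfl | hlt
  · rw [Nat.sub_self, Nat.add_zero]; exact h3
  · obtain ⟨d, hd⟩ := exists_dartAt (P := Q) (k := i + r) (by omega)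
    have h5 := (h4 r (by omega) d hd).head (G := G)
    rw [show A + (L - 1 - r) + 1 = A + (L - r) by omega, PlaneGraph.head, G.rev_rev, hQ.tail hd]
      at h5
    exact h5.symm

theorem Parallel.symm (h : G.Parallel P Q i A L) : G.Parallel Q P A i L := by
  refine ⟨h.2.1, h.1, h.2.2.1.symm, fun r hr d hd => ?_⟩
  obtain ⟨e, he⟩ := exists_dartAt (P := Q) (k := i + r) (by have := h.1; omega)
  rwa [hd.eq (h.2.2.2 r hr e he)]

theorem Antiparallel.symm (h : G.Antiparallel P Q i A L) (hQ : G.IsSimplePath s t Q) :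
    G.Antiparallel Q P A i L := by
  refine ⟨h.2.1, h.1, ?_, fun r hr d hd => ?_⟩
  · have := h.vtx_eq hQ (r := 0) (by omega)
    exact this.symm
  · obtain ⟨e, he⟩ := exists_dartAt (P := Q) (k := i + (L - 1 - r)) (by have := h.1; omega)
    have h1 := h.2.2.2 (L - 1 - r) (by omega) e he
    rw [show L - 1 - (L - 1 - r) = r by omega] at h1
    rwa [hd.eq h1, G.rev_rev]

/-- A run of edges of `Q` that also belong to `P` is traversed by `P` in one direction. -/
theorem exists_run (hP : G.IsSimplePath s t P) (hQ : G.IsSimplePath s t Q) {a : ℕ}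
    (ha : a ≤ P.darts.length) (hv : G.vtx P a = G.vtx Q i) (hi : i + L ≤ Q.darts.length)
    (hsh : ∀ r < L, ∀ d, DartAt Q (i + r) d → d ∈ P.darts ∨ G.rev d ∈ P.darts) :
    ∃ A, G.Parallel P Q i A L ∨ G.Antiparallel P Q i A L := by
  induction L with
  | zero => exact ⟨a, Or.inl ⟨hi, ha, hv, by simp⟩⟩
  | succ L ih =>
    obtain ⟨A, hA⟩ := ih (by omega) fun r hr => hsh r (by omega)
    obtain ⟨d, hd⟩ := exists_dartAt (P := Q) (k := i + L) (by omega)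
    -- `Q` does not turn back along its previous dart
    have hback : ∀ e, 0 < L → DartAt Q (i + L - 1) e → d ≠ G.rev e := by
      intro e _ he hde
      exact hQ.rev_not_mem he.mem (hde ▸ hd.mem)
    rcases hA with hA | hA
    · obtain ⟨h1, h2, h3, h4⟩ := id hA
      rcases hsh L (by omega) d hd with hm | hm
      · obtain ⟨k, hk⟩ := exists_dartAt_of_mem hm
        have hkA := hP.index_of_tail hk h2 (by rw [hA.vtx_eq le_rfl, hQ.tail hd])
        subst hkA
        refine ⟨A, Or.inl ⟨hi, hk.lt, h3, fun r hr e he => ?_⟩⟩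
        rcases Nat.eq_or_lt_of_le (Nat.lt_succ_iff.1 hr) with rfl | hlt
        · rwa [he.eq hd]
        · exact h4 r hlt e he
      · obtain ⟨k, hk⟩ := exists_dartAt_of_mem hm
        have hkA := hP.index_of_head hk h2 (by
          rw [hA.vtx_eq le_rfl, PlaneGraph.head, G.rev_rev, hQ.tail hd])
        rcases Nat.eq_zero_or_pos L with rfl | hL
        · refine ⟨k, Or.inr ⟨hi, by omega, ?_, fun r hr e he => ?_⟩⟩
          · rw [← hP.tail hk, ← hd.head]; rfl
          · obtain rfl : r = 0 := by omega
            rwa [he.eq hd]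
        · obtain ⟨e, he⟩ := exists_dartAt (P := Q) (k := i + L - 1) (by omega)
          have h5 := h4 (L - 1) (by omega) e (by rwa [show i + (L - 1) = i + L - 1 by omega])
          rw [show A + (L - 1) = k by omega] at h5
          exact absurd (by rw [← hk.eq h5, G.rev_rev]) (hback e hL he)
    · obtain ⟨h1, h2, h3, h4⟩ := id hA
      have hprev : ∀ e, 0 < L → DartAt Q (i + L - 1) e → DartAt P A (G.rev e) := by
        intro e hL he
        have h5 := h4 (L - 1) (by omega) e (by rwa [show i + (L - 1) = i + L - 1 by omega])
        rwa [show A + (L - 1 - (L - 1)) = A by omega] at h5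
      rcases hsh L (by omega) d hd with hm | hm
      · obtain ⟨k, hk⟩ := exists_dartAt_of_mem hm
        have hkA := hP.index_of_tail hk (j := A) (by omega) (by rw [h3, hQ.tail hd])
        subst hkA
        rcases Nat.eq_zero_or_pos L with rfl | hL
        · refine ⟨k, Or.inl ⟨hi, hk.lt, h3, fun r hr e he => ?_⟩⟩
          obtain rfl : r = 0 := by omega
          rwa [he.eq hd]
        · obtain ⟨e, he⟩ := exists_dartAt (P := Q) (k := i + L - 1) (by omega)
          exact absurd (hk.eq (hprev e hL he)) (hback e hL he)
      · obtain ⟨k, hk⟩ := exists_dartAt_of_mem hm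
        have hkA := hP.index_of_head hk (j := A) (by omega) (by
          rw [h3, PlaneGraph.head, G.rev_rev, hQ.tail hd])
        refine ⟨k, Or.inr ⟨hi, by omega, ?_, fun r hr e he => ?_⟩⟩
        · rw [← hP.tail hk, ← Nat.add_assoc, ← hd.head]; rfl
        · rcases Nat.eq_or_lt_of_le (Nat.lt_succ_iff.1 hr) with rfl | hlt
          · rw [he.eq hd, show k + (r + 1 - 1 - r) = k by omega]
            exact hk
          · have := h4 r hlt e he
            rwa [show A + (L - 1 - r) = k + (L + 1 - 1 - r) by omega] at this

theorem Parallel.subpath_eq (h : G.Parallel P Q i A L) :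
    G.subpath Q i (i + L) = G.subpath P A (A + L) := by
  refine dartPath_ext h.2.2.1.symm fun k d => ?_
  rw [dartAt_subpath, dartAt_subpath]
  constructor
  · rintro ⟨h1, h2⟩
    exact ⟨by omega, h.2.2.2 k (by omega) d h2⟩
  · rintro ⟨h1, h2⟩
    exact ⟨by omega, h.symm.2.2.2 k (by omega) d h2⟩

theorem Antiparallel.subpath_eq (h : G.Antiparallel P Q i A L) (hQ : G.IsSimplePath s t Q) :
    G.revPath (G.subpath Q i (i + L)) = G.subpath P A (A + L) := by
  have hi := h.1
  refine dartPath_ext ?_ fun k d => ?_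
  · change G.finish (G.subpath Q i (i + L)) = G.vtx P A
    rw [finish_subpath (by omega) h.1, h.2.2.1]
  · rw [dartAt_revPath, length_subpath h.1, dartAt_subpath, dartAt_subpath]
    constructor
    · rintro ⟨h1, h2, h3⟩
      have h4 := h.2.2.2 _ (by omega) _ h3
      rw [show L - 1 - (i + L - i - 1 - k) = k by omega, G.rev_rev] at h4
      exact ⟨by omega, h4⟩
    · rintro ⟨h1, h2⟩
      have h4 := (h.symm hQ).2.2.2 k (by omega) _ h2
      rw [show i + (L - 1 - k) = i + (i + L - i - 1 - k) by omega] at h4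
      exact ⟨by omega, by omega, h4⟩

theorem parallel_of_subpath_eq (hi : i + L ≤ Q.darts.length) (hA : A + L ≤ P.darts.length)
    (h : G.subpath Q i (i + L) = G.subpath P A (A + L)) : G.Parallel P Q i A L := by
  refine ⟨hi, hA, (congrArg DartPath.start h).symm, fun r hr d hd => ?_⟩
  have h1 : DartAt (G.subpath Q i (i + L)) r d := dartAt_subpath.2 ⟨by omega, hd⟩
  rw [h] at h1
  exact (dartAt_subpath.1 h1).2

theorem antiparallel_of_subpath_eq (hi : i + L ≤ Q.darts.length) (hA : A + L ≤ P.darts.length)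
    (h : G.revPath (G.subpath Q i (i + L)) = G.subpath P A (A + L)) :
    G.Antiparallel P Q i A L := by
  refine ⟨hi, hA, ?_, fun r hr d hd => ?_⟩
  · have h1 : G.finish (G.subpath Q i (i + L)) = G.vtx P A := congrArg DartPath.start h
    rw [← h1, finish_subpath (by omega) hi]
  · have h1 : DartAt (G.revPath (G.subpath Q i (i + L))) (L - 1 - r) (G.rev d) := by
      rw [dartAt_revPath, length_subpath hi, G.rev_rev, dartAt_subpath,
        show i + (i + L - i - 1 - (L - 1 - r)) = i + r by omega]
      exact ⟨by omega, by omega, hd⟩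
    rw [h] at h1
    exact (dartAt_subpath.1 h1).2

theorem length_revPath (X : DartPath V D) : (G.revPath X).darts.length = X.darts.length := by
  simp [revPath]

/-- A subpath of `Q` that is shared with `P` is a run. -/
theorem shared_iff (hQ : G.IsSimplePath s t Q) (hi : i + L ≤ Q.darts.length) :
    (G.IsSubpath (G.subpath Q i (i + L)) P ∨ G.IsSubpath (G.revPath (G.subpath Q i (i + L))) P) ↔
      ∃ A, G.Parallel P Q i A L ∨ G.Antiparallel P Q i A L := by
  constructor
  · rintro (h | h) <;> obtain ⟨A, M, hA, h⟩ := isSubpath_iff.1 h <;>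
      have hlen := congrArg (fun X : DartPath V D => X.darts.length) h <;>
      simp only [length_subpath hi, length_subpath hA, length_revPath] at hlen <;>
      obtain rfl : L = M := by omega
    · exact ⟨A, Or.inl (parallel_of_subpath_eq hi hA h)⟩
    · exact ⟨A, Or.inr (antiparallel_of_subpath_eq hi hA h)⟩
  · rintro ⟨A, h | h⟩
    · exact Or.inl (isSubpath_iff.2 ⟨A, L, h.2.1, h.subpath_eq⟩)
    · exact Or.inr (isSubpath_iff.2 ⟨A, L, h.2.1, h.subpath_eq hQ⟩)

theorem Parallel.mem (h : G.Parallel P Q i A L) {k : ℕ} {d : D} (hd : DartAt Q k d) (h1 : i ≤ k)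
    (h2 : k < i + L) : d ∈ P.darts :=
  (h.2.2.2 (k - i) (by omega) d (by rwa [Nat.add_sub_cancel' h1])).mem

theorem Antiparallel.mem (h : G.Antiparallel P Q i A L) {k : ℕ} {d : D} (hd : DartAt Q k d)
    (h1 : i ≤ k) (h2 : k < i + L) : G.rev d ∈ P.darts :=
  (h.2.2.2 (k - i) (by omega) d (by rwa [Nat.add_sub_cancel' h1])).mem

theorem run_mem (h : G.Parallel P Q i A L ∨ G.Antiparallel P Q i A L) {k : ℕ} {d : D}
    (hd : DartAt Q k d) (h1 : i ≤ k) (h2 : k < i + L) : d ∈ P.darts ∨ G.rev d ∈ P.darts :=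
  h.imp (fun h => h.mem hd h1 h2) (fun h => h.mem hd h1 h2)

theorem exists_vtx_eq_of_mem (hP : G.IsSimplePath s t P) {d : D}
    (h : d ∈ P.darts ∨ G.rev d ∈ P.darts) : ∃ a ≤ P.darts.length, G.vtx P a = G.tail d := by
  rcases h with h | h <;> obtain ⟨k, hk⟩ := exists_dartAt_of_mem h
  · exact ⟨k, hk.lt.le, (hP.tail hk).symm⟩
  · exact ⟨k + 1, hk.lt, by rw [← hk.head, PlaneGraph.head, G.rev_rev]⟩

namespace IsComponent

theorem le_Q (h : G.IsComponent P Q i A L) : i + L ≤ Q.darts.length :=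
  h.run.elim (fun h => h.1) (fun h => h.1)

theorem le_P (h : G.IsComponent P Q i A L) : A + L ≤ P.darts.length :=
  h.run.elim (fun h => h.2.1) (fun h => h.2.1)

/-- A component of the intersection of `Q` with `P` is one of the intersection of `P` with `Q`. -/
theorem symm (h : G.IsComponent P Q i A L) (hP : G.IsSimplePath s t P)
    (hQ : G.IsSimplePath s t Q) : G.IsComponent Q P A i L := by
  have hiL := h.le_Q
  have hAL := h.le_P
  obtain ⟨hrun, hbef, haft⟩ := h
  refine ⟨hrun.imp (fun h => h.symm) (fun h => h.symm hQ), ?_, ?_⟩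
  · intro k e hkA he
    have hhead : G.head e = G.vtx P A := by rw [he.head, hkA]
    rcases hrun with h | h
    · rw [h.2.2.1] at hhead
      constructor <;> intro hm <;> obtain ⟨m, hm⟩ := exists_dartAt_of_mem hm
      · exact (hbef m e (hQ.index_of_head hm (by omega) hhead) hm).1 he.mem
      · obtain rfl := hQ.index_of_tail hm (j := i) (by omega) hhead
        rcases Nat.eq_zero_or_pos L with rfl | hL
        · exact (haft _ hm).2 (by rw [G.rev_rev]; exact he.mem)
        · exact hP.rev_not_mem he.mem (h.mem hm le_rfl (by omega))
    · rw [h.2.2.1] at hhead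
      constructor <;> intro hm <;> obtain ⟨m, hm⟩ := exists_dartAt_of_mem hm
      · have h1 := hQ.index_of_head hm hiL hhead
        rcases Nat.eq_zero_or_pos L with rfl | hL
        · exact (hbef m e h1 hm).1 he.mem
        · exact hP.rev_not_mem he.mem (h.mem hm (by omega) (by omega))
      · obtain rfl := hQ.index_of_tail hm hiL hhead
        exact (haft _ hm).2 (by rw [G.rev_rev]; exact he.mem)
  · intro e he
    have htail := hP.tail he
    rcases hrun with h | h
    · rw [h.vtx_eq le_rfl] at htail
      constructor <;> intro hm <;> obtain ⟨m, hm⟩ := exists_dartAt_of_mem hm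
      · obtain rfl := hQ.index_of_tail hm hiL htail
        exact (haft _ hm).1 he.mem
      · have h1 := hQ.index_of_head hm hiL (by rw [PlaneGraph.head, G.rev_rev, htail])
        rcases Nat.eq_zero_or_pos L with rfl | hL
        · exact (hbef m _ h1 hm).2 (by rw [G.rev_rev]; exact he.mem)
        · exact hP.rev_not_mem he.mem (h.mem hm (by omega) (by omega))
    · rw [show A + L = A + (L - 0) by omega, h.vtx_eq hQ (r := 0) (by omega)] at htail
      constructor <;> intro hm <;> obtain ⟨m, hm⟩ := exists_dartAt_of_mem hm
      · obtain rfl := hQ.index_of_tail hm (j := i) (by omega) htail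
        rcases Nat.eq_zero_or_pos L with rfl | hL
        · exact (haft _ hm).1 he.mem
        · exact hP.rev_not_mem he.mem (h.mem hm le_rfl (by omega))
      · have h1 := hQ.index_of_head hm (j := i) (by omega)
          (by rw [PlaneGraph.head, G.rev_rev, htail]; rfl)
        exact (hbef m _ h1 hm).2 (by rw [G.rev_rev]; exact he.mem)

/-- Every vertex of a component of `Q` is the corresponding vertex of `P`. -/
theorem exists_vtx_P (h : G.IsComponent P Q i A L) (hQ : G.IsSimplePath s t Q) {k : ℕ}
    (h1 : i ≤ k) (h2 : k ≤ i + L) : ∃ a, A ≤ a ∧ a ≤ A + L ∧ G.vtx P a = G.vtx Q k := by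
  rcases h.run with h | h
  · exact ⟨A + (k - i), by omega, by omega, by
      rw [h.vtx_eq (by omega), Nat.add_sub_cancel' h1]⟩
  · exact ⟨A + (L - (k - i)), by omega, by omega, by
      rw [h.vtx_eq hQ (by omega), Nat.add_sub_cancel' h1]⟩

theorem exists_vtx_Q (h : G.IsComponent P Q i A L) (hP : G.IsSimplePath s t P)
    (hQ : G.IsSimplePath s t Q) {a : ℕ} (h1 : A ≤ a) (h2 : a ≤ A + L) :
    ∃ k, i ≤ k ∧ k ≤ i + L ∧ G.vtx Q k = G.vtx P a :=
  (h.symm hP hQ).exists_vtx_P hP h1 h2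

/-- Components of the intersection with a path are disjoint. -/
theorem lt_of_lt {j B M : ℕ} (h : G.IsComponent P Q i A L) (h' : G.IsComponent P Q j B M)
    (hij : i < j) : i + L < j := by
  by_contra hcon
  obtain ⟨d, hd⟩ := exists_dartAt (P := Q) (k := j - 1) (by have := h.le_Q; omega)
  have h1 := h'.before (j - 1) d (by omega) hd
  rcases run_mem h.run hd (by omega) (by omega) with h2 | h2
  · exact h1.1 h2
  · exact h1.2 h2

theorem length_unique {B M : ℕ} (h : G.IsComponent P Q i A L) (h' : G.IsComponent P Q i B M) :
    L = M := by
  have key : ∀ {A L B M}, G.IsComponent P Q i A L → G.IsComponent P Q i B M → ¬ L < M := by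
    intro A L B M h h' hlt
    obtain ⟨d, hd⟩ := exists_dartAt (P := Q) (k := i + L) (by have := h'.le_Q; omega)
    have h1 := h.after d hd
    rcases run_mem h'.run hd (by omega) (by omega) with h2 | h2
    · exact h1.1 h2
    · exact h1.2 h2
  have h1 := key h h'
  have h2 := key h' h
  omega

end IsComponent

/-- The maximal shared subpaths are the components of the intersection. -/
theorem isMaxShared_iff (hP : G.IsSimplePath s t P) (hQ : G.IsSimplePath s t Q)
    {X : DartPath V D} :
    G.IsMaxShared P Q X ↔ ∃ i A L, X = G.subpath Q i (i + L) ∧ G.IsComponent P Q i A L := by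
  constructor
  · rintro ⟨hXQ, hsh, hmax⟩
    obtain ⟨i, L, hi, rfl⟩ := isSubpath_iff.1 hXQ
    obtain ⟨A, hA⟩ := (shared_iff hQ hi).1 hsh
    -- a longer shared subpath contradicts maximality
    have hext : ∀ j M, j ≤ i → i + L ≤ j + M → j + M ≤ Q.darts.length → L < M →
        (∃ a ≤ P.darts.length, G.vtx P a = G.vtx Q j) →
        (∀ k d, DartAt Q k d → j ≤ k → k < j + M → ¬ (i ≤ k ∧ k < i + L) →
          d ∈ P.darts ∨ G.rev d ∈ P.darts) → False := by
      rintro j M hj hM hle hLM ⟨a, ha, hv⟩ hd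
      obtain ⟨B, hB⟩ := exists_run hP hQ ha hv hle (fun r hr d hdr => by
        by_cases hk : i ≤ j + r ∧ j + r < i + L
        · exact run_mem hA hdr hk.1 hk.2
        · exact hd _ d hdr (by omega) (by omega) hk)
      have h1 := hmax _ (isSubpath_iff.2 ⟨j, M, hle, rfl⟩) ((shared_iff hQ hle).2 ⟨B, hB⟩)
        ⟨i - j, i - j + L, by omega, by rw [length_subpath hle]; omega, by
          rw [subpath_subpath hle (by omega) (by omega)]
          congr 1 <;> omega⟩
      have := (hQ.subpath_inj hle hi h1).2
      omega
    refine ⟨i, A, L, rfl, hA, ?_, ?_⟩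
    · intro k d hk hd
      rw [← not_or]
      intro hm
      refine hext k (L + 1) (by omega) (by omega) (by omega) (by omega) ?_ ?_
      · rw [← hQ.tail hd]; exact exists_vtx_eq_of_mem hP hm
      · intro m e he h1 h2 h3
        obtain rfl : m = k := by omega
        rwa [he.eq hd]
    · intro d hd
      rw [← not_or]
      intro hm
      refine hext i (L + 1) le_rfl (by omega) hd.lt (by omega) ?_ ?_
      · rcases hA with h | h
        · exact ⟨A, by have := h.2.1; omega, h.2.2.1⟩
        · exact ⟨A + L, h.2.1, h.vtx_eq hQ (r := 0) (by omega)⟩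
      · intro m e he h1 h2 h3
        obtain rfl : m = i + L := by omega
        rwa [he.eq hd]
  · rintro ⟨i, A, L, rfl, h⟩
    have hi := h.le_Q
    refine ⟨isSubpath_iff.2 ⟨i, L, hi, rfl⟩, (shared_iff hQ hi).2 ⟨A, h.run⟩, ?_⟩
    intro X' hX' hsh hsub
    obtain ⟨j, M, hj, rfl⟩ := isSubpath_iff.1 hX'
    obtain ⟨B, hB⟩ := (shared_iff hQ hj).1 hsh
    obtain ⟨a, N, haN, heq⟩ := isSubpath_iff.1 hsub
    rw [length_subpath hj] at haN
    rw [subpath_subpath hj (by omega) (by omega), ← Nat.add_assoc] at heq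
    obtain ⟨rfl, rfl⟩ := hQ.subpath_inj hi (by omega) heq
    have h1 : a = 0 := by
      by_contra h0
      obtain ⟨d, hd⟩ := exists_dartAt (P := Q) (k := j + a - 1) (by omega)
      have h2 := h.before _ d (by omega) hd
      rcases run_mem hB hd (by omega) (by omega) with h3 | h3
      · exact h2.1 h3
      · exact h2.2 h3
    subst h1
    have h2 : L = M := by
      by_contra h0
      obtain ⟨d, hd⟩ := exists_dartAt (P := Q) (k := j + 0 + L) (by omega)
      have h2 := h.after d hd
      rcases run_mem hB hd (by omega) (by omega) with h3 | h3
      · exact h2.1 h3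
      · exact h2.2 h3
    subst h2
    rfl

end PlaneGraph

namespace PlaneGraph

variable {V D F : Type*} [Fintype V] [Fintype D] [Fintype F] {G : PlaneGraph V D F}
  {s t : V} {P Q : DartPath V D}

/-! ### Crossings in terms of indices -/

variable (G) in
/-- The component of `P` and `Q` given by `i`, `A`, `L` is a crossing, in either direction. -/
def CrossesAt (P Q : DartPath V D) (i A L : ℕ) : Prop :=
  G.IsComponent P Q i A L ∧
    (G.EntersRight P Q (G.vtx P A) ∧ G.LeavesLeft P Q (G.vtx P (A + L)) ∨
      G.EntersLeft P Q (G.vtx P A) ∧ G.LeavesRight P Q (G.vtx P (A + L)))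

/-- In a maximal shared subpath, the vertex that `P` reaches first (last) is the one where `P` has
the lower (higher) index. -/
theorem isMaxShared_and_iff (hP : G.IsSimplePath s t P) (hQ : G.IsSimplePath s t Q)
    (E L' : V → Prop) {X : DartPath V D} :
    (G.IsMaxShared P Q X ∧ ((G.IsSubpath X P ∧ E X.start ∧ L' (G.finish X)) ∨
      (G.IsSubpath (G.revPath X) P ∧ E (G.finish X) ∧ L' X.start))) ↔
    ∃ i A L, X = G.subpath Q i (i + L) ∧ G.IsComponent P Q i A L ∧ E (G.vtx P A) ∧
      L' (G.vtx P (A + L)) := by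
  rw [isMaxShared_iff hP hQ]
  constructor
  · rintro ⟨⟨i, A, L, rfl, h⟩, ⟨hs, h1, h2⟩ | ⟨hs, h1, h2⟩⟩ <;>
      have hi := h.le_Q <;>
      obtain ⟨B, M, hB, heq⟩ := isSubpath_iff.1 hs <;>
      have hlen := congrArg (fun X : DartPath V D => X.darts.length) heq <;>
      simp only [length_subpath hi, length_subpath hB, length_revPath] at hlen <;>
      obtain rfl : L = M := by omega
    · have hpar := parallel_of_subpath_eq hi hB heq
      refine ⟨i, B, L, rfl, ⟨Or.inl hpar, h.before, h.after⟩, ?_, ?_⟩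
      · rwa [hpar.2.2.1]
      · rwa [hpar.vtx_eq le_rfl, ← finish_subpath (Nat.le_add_right _ _) hi]
    · have hanti := antiparallel_of_subpath_eq hi hB heq
      refine ⟨i, B, L, rfl, ⟨Or.inr hanti, h.before, h.after⟩, ?_, ?_⟩
      · rwa [hanti.2.2.1, ← finish_subpath (Nat.le_add_right _ _) hi]
      · have := hanti.vtx_eq hQ (r := 0) (Nat.zero_le _)
        rw [Nat.sub_zero] at this
        rwa [this]
  · rintro ⟨i, A, L, rfl, h, h1, h2⟩
    have hi := h.le_Q
    refine ⟨⟨i, A, L, rfl, h⟩, ?_⟩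
    rw [finish_subpath (Nat.le_add_right _ _) hi, subpath_start]
    rcases h.run with hr | hr
    · left
      refine ⟨isSubpath_iff.2 ⟨A, L, hr.2.1, hr.subpath_eq⟩, ?_, ?_⟩
      · rwa [← hr.2.2.1]
      · rwa [← hr.vtx_eq le_rfl]
    · right
      refine ⟨isSubpath_iff.2 ⟨A, L, hr.2.1, hr.subpath_eq hQ⟩, ?_, ?_⟩
      · rwa [← hr.2.2.1]
      · have := hr.vtx_eq hQ (r := 0) (Nat.zero_le _)
        rw [Nat.sub_zero] at this
        exact this ▸ h2

theorem crossesRightToLeft_iff (hP : G.IsSimplePath s t P) (hQ : G.IsSimplePath s t Q)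
    {X : DartPath V D} :
    G.CrossesRightToLeft P Q X ↔ ∃ i A L, X = G.subpath Q i (i + L) ∧ G.IsComponent P Q i A L ∧
      G.EntersRight P Q (G.vtx P A) ∧ G.LeavesLeft P Q (G.vtx P (A + L)) :=
  isMaxShared_and_iff hP hQ _ _

theorem crossesLeftToRight_iff (hP : G.IsSimplePath s t P) (hQ : G.IsSimplePath s t Q)
    {X : DartPath V D} :
    G.CrossesLeftToRight P Q X ↔ ∃ i A L, X = G.subpath Q i (i + L) ∧ G.IsComponent P Q i A L ∧
      G.EntersLeft P Q (G.vtx P A) ∧ G.LeavesRight P Q (G.vtx P (A + L)) :=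
  isMaxShared_and_iff hP hQ _ _

theorem crosses_iff (hP : G.IsSimplePath s t P) (hQ : G.IsSimplePath s t Q)
    {X : DartPath V D} :
    (G.CrossesRightToLeft P Q X ∨ G.CrossesLeftToRight P Q X) ↔
      ∃ i A L, X = G.subpath Q i (i + L) ∧ G.CrossesAt P Q i A L := by
  rw [crossesRightToLeft_iff hP hQ, crossesLeftToRight_iff hP hQ]
  constructor
  · rintro (⟨i, A, L, h, h1, h2⟩ | ⟨i, A, L, h, h1, h2⟩)
    · exact ⟨i, A, L, h, h1, Or.inl h2⟩
    · exact ⟨i, A, L, h, h1, Or.inr h2⟩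
  · rintro ⟨i, A, L, h, h1, h2 | h2⟩
    · exact Or.inl ⟨i, A, L, h, h1, h2⟩
    · exact Or.inr ⟨i, A, L, h, h1, h2⟩

/-! ### Entering and leaving at a vertex -/

theorem IsSimplePath.eq_of_tail_eq (hP : G.IsSimplePath s t P) {d e : D} (hd : d ∈ P.darts)
    (he : e ∈ P.darts) (h : G.tail d = G.tail e) : d = e := by
  obtain ⟨k, hk⟩ := exists_dartAt_of_mem hd
  obtain ⟨m, hm⟩ := exists_dartAt_of_mem he
  obtain rfl := hP.index_of_tail hk hm.lt.le (h.trans (hP.tail hm))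
  exact hk.eq hm

theorem IsSimplePath.eq_of_head_eq (hP : G.IsSimplePath s t P) {d e : D} (hd : d ∈ P.darts)
    (he : e ∈ P.darts) (h : G.head d = G.head e) : d = e := by
  obtain ⟨k, hk⟩ := exists_dartAt_of_mem hd
  obtain ⟨m, hm⟩ := exists_dartAt_of_mem he
  obtain rfl : k = m := by
    have := hP.index_of_head hk hm.lt (h.trans hm.head)
    omega
  exact hk.eq hm

variable (G) in
/-- `a` and `b` are consecutive darts of the path, meeting at `v`. -/
def Consecutive (Q : DartPath V D) (v : V) (a b : D) : Prop :=
  [a, b] <:+: Q.darts ∧ G.head a = v ∧ G.tail b = v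

theorem Consecutive.mem_left {v : V} {a b : D} (h : G.Consecutive Q v a b) : a ∈ Q.darts :=
  h.1.subset (by simp)

theorem Consecutive.mem_right {v : V} {a b : D} (h : G.Consecutive Q v a b) : b ∈ Q.darts :=
  h.1.subset (by simp)

theorem Consecutive.ne_rev {v : V} {a b : D} (h : G.Consecutive Q v a b)
    (hQ : G.IsSimplePath s t Q) : b ≠ G.rev a := fun hb =>
  hQ.rev_not_mem h.mem_left (hb ▸ h.mem_right)

theorem consecutive_of_dartAt (hQ : G.IsSimplePath s t Q) {k : ℕ} {a b : D} (ha : DartAt Q k a)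
    (hb : DartAt Q (k + 1) b) : G.Consecutive Q (G.vtx Q (k + 1)) a b :=
  ⟨pair_infix_iff.2 ⟨k, ha, hb⟩, ha.head, hQ.tail hb⟩

section local_crossing

variable {v : V} {a b e : D}

theorem entersRight_iff (hP : G.IsSimplePath s t P) (hQ : G.IsSimplePath s t Q)
    (hab : G.Consecutive Q v a b) (he : e ∈ P.darts) (hv : G.head e = v) :
    G.EntersRight P Q v ↔ G.CwOrder b (G.rev e) (G.rev a) := by
  constructor
  · rintro ⟨e', he', a', b', h, h1, h2, h3, h4⟩
    have hc : G.Consecutive Q v a' b' := ⟨h, h1, h2⟩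
    rwa [hP.eq_of_head_eq he he' (hv.trans h3.symm),
      hQ.eq_of_head_eq hab.mem_left hc.mem_left (hab.2.1.trans h1.symm),
      hQ.eq_of_tail_eq hab.mem_right hc.mem_right (hab.2.2.trans h2.symm)]
  · intro h
    exact ⟨e, he, a, b, hab.1, hab.2.1, hab.2.2, hv, h⟩

theorem entersLeft_iff (hP : G.IsSimplePath s t P) (hQ : G.IsSimplePath s t Q)
    (hab : G.Consecutive Q v a b) (he : e ∈ P.darts) (hv : G.head e = v) :
    G.EntersLeft P Q v ↔ G.CwOrder (G.rev a) (G.rev e) b := by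
  constructor
  · rintro ⟨e', he', a', b', h, h1, h2, h3, h4⟩
    have hc : G.Consecutive Q v a' b' := ⟨h, h1, h2⟩
    rwa [hP.eq_of_head_eq he he' (hv.trans h3.symm),
      hQ.eq_of_head_eq hab.mem_left hc.mem_left (hab.2.1.trans h1.symm),
      hQ.eq_of_tail_eq hab.mem_right hc.mem_right (hab.2.2.trans h2.symm)]
  · intro h
    exact ⟨e, he, a, b, hab.1, hab.2.1, hab.2.2, hv, h⟩

theorem leavesRight_iff (hP : G.IsSimplePath s t P) (hQ : G.IsSimplePath s t Q)
    (hab : G.Consecutive Q v a b) (he : e ∈ P.darts) (hv : G.tail e = v) :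
    G.LeavesRight P Q v ↔ G.CwOrder b e (G.rev a) := by
  constructor
  · rintro ⟨e', he', a', b', h, h1, h2, h3, h4⟩
    have hc : G.Consecutive Q v a' b' := ⟨h, h1, h2⟩
    rwa [hP.eq_of_tail_eq he he' (hv.trans h3.symm),
      hQ.eq_of_head_eq hab.mem_left hc.mem_left (hab.2.1.trans h1.symm),
      hQ.eq_of_tail_eq hab.mem_right hc.mem_right (hab.2.2.trans h2.symm)]
  · intro h
    exact ⟨e, he, a, b, hab.1, hab.2.1, hab.2.2, hv, h⟩

theorem leavesLeft_iff (hP : G.IsSimplePath s t P) (hQ : G.IsSimplePath s t Q)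
    (hab : G.Consecutive Q v a b) (he : e ∈ P.darts) (hv : G.tail e = v) :
    G.LeavesLeft P Q v ↔ G.CwOrder (G.rev a) e b := by
  constructor
  · rintro ⟨e', he', a', b', h, h1, h2, h3, h4⟩
    have hc : G.Consecutive Q v a' b' := ⟨h, h1, h2⟩
    rwa [hP.eq_of_tail_eq he he' (hv.trans h3.symm),
      hQ.eq_of_head_eq hab.mem_left hc.mem_left (hab.2.1.trans h1.symm),
      hQ.eq_of_tail_eq hab.mem_right hc.mem_right (hab.2.2.trans h2.symm)]
  · intro h
    exact ⟨e, he, a, b, hab.1, hab.2.1, hab.2.2, hv, h⟩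

theorem rev_injective (G : PlaneGraph V D F) : Function.Injective G.rev := fun a b h => by
  rw [← G.rev_rev a, h, G.rev_rev]

theorem entersLeft_iff_not (hP : G.IsSimplePath s t P) (hQ : G.IsSimplePath s t Q)
    (hab : G.Consecutive Q v a b) (he : e ∈ P.darts) (hv : G.head e = v)
    (h1 : e ∉ Q.darts) (h2 : G.rev e ∉ Q.darts) :
    G.EntersLeft P Q v ↔ ¬ G.EntersRight P Q v := by
  rw [entersLeft_iff hP hQ hab he hv, entersRight_iff hP hQ hab he hv]
  refine (not_cwOrder_iff (hab.2.2.trans hv.symm) (hab.2.2.trans hab.2.1.symm) ?_ ?_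
    (hab.ne_rev hQ)).symm
  · rintro rfl; exact h2 hab.mem_right
  · intro h; exact h1 (G.rev_injective h ▸ hab.mem_left)

theorem leavesLeft_iff_not (hP : G.IsSimplePath s t P) (hQ : G.IsSimplePath s t Q)
    (hab : G.Consecutive Q v a b) (he : e ∈ P.darts) (hv : G.tail e = v)
    (h1 : e ∉ Q.darts) (h2 : G.rev e ∉ Q.darts) :
    G.LeavesLeft P Q v ↔ ¬ G.LeavesRight P Q v := by
  rw [leavesLeft_iff hP hQ hab he hv, leavesRight_iff hP hQ hab he hv]
  refine (not_cwOrder_iff (hab.2.2.trans hv.symm) (hab.2.2.trans hab.2.1.symm) ?_ ?_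
    (hab.ne_rev hQ)).symm
  · rintro rfl; exact h1 hab.mem_right
  · rintro rfl; exact h2 (by rw [G.rev_rev]; exact hab.mem_left)

/-- A dart that lies strictly to the right of `Q` at `v` does not belong to an edge of `Q`. -/
theorem not_mem_of_cwOrder (hQ : G.IsSimplePath s t Q) (hab : G.Consecutive Q v a b)
    (h : G.CwOrder b e (G.rev a)) : e ∉ Q.darts ∧ G.rev e ∉ Q.darts := by
  have htail := h.tail_eq
  constructor
  · intro he
    exact h.ne_left (hab.2.2.trans hab.2.1.symm) (hQ.eq_of_tail_eq hab.mem_right he htail)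
  · intro he
    refine h.ne_right ?_
    rw [hQ.eq_of_head_eq hab.mem_left he, G.rev_rev]
    rw [PlaneGraph.head, PlaneGraph.head, G.rev_rev, ← htail, hab.2.2]
    exact hab.2.1

end local_crossing

theorem mem_subpath {d : D} {A B : ℕ} :
    d ∈ (G.subpath P A B).darts ↔ ∃ k, A ≤ k ∧ k < B ∧ DartAt P k d := by
  constructor
  · intro h
    obtain ⟨k, hk⟩ := exists_dartAt_of_mem h
    obtain ⟨h1, h2⟩ := dartAt_subpath.1 hk
    exact ⟨A + k, by omega, h1, h2⟩
  · rintro ⟨k, h1, h2, h3⟩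
    have : DartAt (G.subpath P A B) (k - A) d :=
      dartAt_subpath.2 ⟨by omega, by rwa [Nat.add_sub_cancel' h1]⟩
    exact this.mem

theorem flow_subpath_eq_zero (hP : G.IsSimplePath s t P) {A B : ℕ} {v : V}
    (hv : ∀ a, A ≤ a → a ≤ B → G.vtx P a ≠ v) {d : D} (hd : G.tail d = v) :
    G.flow (G.subpath P A B).darts d = 0 := by
  refine G.flow_eq_zero ?_ ?_ <;> rw [mem_subpath] <;> rintro ⟨k, h1, h2, h3⟩
  · exact hv k h1 h2.le (by rw [← hP.tail h3, hd])
  · exact hv (k + 1) (by omega) h2 (by rw [← h3.head, PlaneGraph.head, G.rev_rev, hd])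

theorem nodup_subpath (hP : G.IsSimplePath s t P) (A B : ℕ) :
    (G.subpath P A B).darts.Nodup :=
  hP.nodup_darts.sublist ((List.drop_sublist _ _).trans (List.take_sublist _ _))

theorem subpath_subset (P : DartPath V D) (A B : ℕ) :
    (G.subpath P A B).darts ⊆ P.darts :=
  ((List.drop_sublist _ _).trans (List.take_sublist _ _)).subset

/-- The potential to the right of `Q` does not change at a vertex where nothing flows to the
right. -/
theorem IsPotential.right_eq {φ : F → ℤ} {θ : D → ℤ} (h : G.IsPotential φ θ)
    (hQ : G.IsSimplePath s t Q) {v : V} {a b : D} (hab : G.Consecutive Q v a b)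
    (h0 : ∀ d, G.CwOrder b d (G.rev a) → θ d = 0) : φ (G.right a) = φ (G.right b) := by
  classical
  have h1 := h.sub_eq_sum_cwOrder (x := b) (z := G.rev a) (hab.2.2.trans hab.2.1.symm)
    (hab.ne_rev hQ)
  rw [Finset.sum_eq_zero fun d hd => h0 d (Finset.mem_filter.1 hd).2, G.rev_rev] at h1
  omega

open Classical in
/-- The change of the potential to the right of `Q` at a vertex through which one unit flows along
`P`. -/
theorem IsPotential.right_sub_right {φ : F → ℤ} {θ : D → ℤ} (h : G.IsPotential φ θ)
    (hP : G.IsSimplePath s t P) (hQ : G.IsSimplePath s t Q) {v : V} {a b : D}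
    (hab : G.Consecutive Q v a b) {A B x : ℕ} (hB : B ≤ P.darts.length) (hA : A < x) (hx : x < B)
    (hv : G.vtx P x = v)
    (hθ : ∀ d, G.tail d = v → θ d = G.flow (G.subpath P A B).darts d) :
    φ (G.right a) - φ (G.right b) =
      (if G.LeavesRight P Q v then 1 else 0) - (if G.EntersRight P Q v then 1 else 0) := by
  obtain ⟨e, he⟩ := exists_dartAt (P := P) (k := x - 1) (by omega)
  obtain ⟨e', he'⟩ := exists_dartAt (P := P) (k := x) (by omega)
  have hev : G.head e = v := by rw [he.head, ← hv, Nat.sub_add_cancel (by omega)]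
  have hev' : G.tail e' = v := by rw [hP.tail he', hv]
  have hnd := nodup_subpath hP A B
  have hmem : e ∈ (G.subpath P A B).darts := mem_subpath.2 ⟨x - 1, by omega, by omega, he⟩
  have hmem' : e' ∈ (G.subpath P A B).darts := mem_subpath.2 ⟨x, by omega, by omega, he'⟩
  have hrev : ∀ d ∈ (G.subpath P A B).darts, G.rev d ∉ (G.subpath P A B).darts := fun d h h' =>
    hP.rev_not_mem (subpath_subset P A B h) (subpath_subset P A B h')
  have hval : ∀ d, G.tail d = v →
      θ d = (if d = e' then 1 else 0) - (if d = G.rev e then 1 else 0) := by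
    intro d hd
    rw [hθ d hd]
    by_cases h1 : d = e'
    · have h2 : d ≠ G.rev e := by
        rintro rfl
        exact hP.rev_not_mem he.mem (h1 ▸ he'.mem)
      rw [if_pos h1, if_neg h2, h1, G.flow_eq_one hnd hmem' (hrev _ hmem')]
      rfl
    · by_cases h2 : d = G.rev e
      · rw [if_neg h1, if_pos h2, h2, G.flow_rev, G.flow_eq_one hnd hmem (hrev _ hmem)]
        rfl
      · rw [if_neg h1, if_neg h2, G.flow_eq_zero]
        · rfl
        · intro hm
          exact h1 (hP.eq_of_tail_eq (subpath_subset P A B hm) he'.mem (hd.trans hev'.symm))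
        · intro hm
          refine h2 ?_
          rw [← hP.eq_of_head_eq (subpath_subset P A B hm) he.mem, G.rev_rev]
          rw [hev, PlaneGraph.head, G.rev_rev, hd]
  have h1 := h.sub_eq_sum_cwOrder (x := b) (z := G.rev a) (hab.2.2.trans hab.2.1.symm)
    (hab.ne_rev hQ)
  rw [G.rev_rev, Finset.sum_congr rfl fun d hd =>
    hval d ((Finset.mem_filter.1 hd).2.tail_eq.symm.trans hab.2.2), Finset.sum_sub_distrib,
    Finset.sum_ite_eq', Finset.sum_ite_eq'] at h1
  simp only [Finset.mem_filter, Finset.mem_univ, true_and] at h1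
  rw [h1, ← entersRight_iff hP hQ hab he.mem hev, ← leavesRight_iff hP hQ hab he'.mem hev']

end PlaneGraph

namespace PlaneGraph

variable {V D F : Type*} [Fintype V] [Fintype D] [Fintype F] {G : PlaneGraph V D F}
  {s t : V} {P Q : DartPath V D}

/-! ### The potential along a path without crossings -/

theorem IsSimplePath.exists_consecutive (hQ : G.IsSimplePath s t Q) {k : ℕ} (h0 : 0 < k)
    (hk : k < Q.darts.length) : ∃ a b, DartAt Q (k - 1) a ∧ DartAt Q k b ∧
      G.Consecutive Q (G.vtx Q k) a b := by
  obtain ⟨a, ha⟩ := exists_dartAt (P := Q) (k := k - 1) (by omega)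
  obtain ⟨b, hb⟩ := exists_dartAt (P := Q) (k := k - 1 + 1) (by omega)
  have h := consecutive_of_dartAt hQ ha hb
  rw [Nat.sub_add_cancel h0] at h hb
  exact ⟨a, b, ha, hb, h⟩

/-- If `P` leaves the vertex along an edge of `Q`, it does not leave `Q` to the right. -/
theorem not_leavesRight_of_mem (hP : G.IsSimplePath s t P) (hQ : G.IsSimplePath s t Q) {v : V}
    {e : D} (he : e ∈ P.darts) (hv : G.tail e = v) (h : e ∈ Q.darts ∨ G.rev e ∈ Q.darts) :
    ¬ G.LeavesRight P Q v := by
  rintro ⟨e', he', a, b, hab, h1, h2, h3, h4⟩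
  obtain rfl := hP.eq_of_tail_eq he he' (hv.trans h3.symm)
  have := not_mem_of_cwOrder hQ ⟨hab, h1, h2⟩ h4
  tauto

/-- If `P` reaches the vertex along an edge of `Q`, it does not enter `Q` from the right. -/
theorem not_entersRight_of_mem (hP : G.IsSimplePath s t P) (hQ : G.IsSimplePath s t Q) {v : V}
    {e : D} (he : e ∈ P.darts) (hv : G.head e = v) (h : e ∈ Q.darts ∨ G.rev e ∈ Q.darts) :
    ¬ G.EntersRight P Q v := by
  rintro ⟨e', he', a, b, hab, h1, h2, h3, h4⟩
  obtain rfl := hP.eq_of_head_eq he he' (hv.trans h3.symm)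
  have := not_mem_of_cwOrder hQ ⟨hab, h1, h2⟩ h4
  rw [G.rev_rev] at this
  tauto

open Classical in
/-- Along a component of `P` and `Q` in the interior of the flow along `P`, the potential to the
right of `Q` changes only at the two ends of the component. -/
theorem IsComponent.right_sub_right {φ : F → ℤ} {θ : D → ℤ} (hφ : G.IsPotential φ θ)
    (hP : G.IsSimplePath s t P) (hQ : G.IsSimplePath s t Q) {i C L A B : ℕ}
    (h : G.IsComponent P Q (i + 1) C L) (hA : A < C) (hB : C + L < B) (hBP : B ≤ P.darts.length)
    (hθ : ∀ r, i < r → r ≤ i + 1 + L → ∀ d, G.tail d = G.vtx Q r →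
      θ d = G.flow (G.subpath P A B).darts d) {a b : D} (ha : DartAt Q i a)
    (hb : DartAt Q (i + 1 + L) b) :
    φ (G.right a) - φ (G.right b) =
      (if G.LeavesRight P Q (G.vtx P (C + L)) then 1 else 0) -
        (if G.EntersRight P Q (G.vtx P C) then 1 else 0) := by
  have hbQ := hb.lt
  have hsymm := h.symm hP hQ
  -- the sum of the changes at the vertices of the component
  have hsum : ∀ m ≤ L, ∀ b, DartAt Q (i + 1 + m) b → φ (G.right a) - φ (G.right b) =
      ∑ r ∈ Finset.range (m + 1),
        ((if G.LeavesRight P Q (G.vtx Q (i + 1 + r)) then (1 : ℤ) else 0) -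
          (if G.EntersRight P Q (G.vtx Q (i + 1 + r)) then 1 else 0)) := by
    have hstep : ∀ m ≤ L, ∀ a b, DartAt Q (i + m) a → DartAt Q (i + 1 + m) b →
        φ (G.right a) - φ (G.right b) =
          (if G.LeavesRight P Q (G.vtx Q (i + 1 + m)) then (1 : ℤ) else 0) -
            (if G.EntersRight P Q (G.vtx Q (i + 1 + m)) then 1 else 0) := by
      intro m hm a b ha hb
      obtain ⟨x, h1, h2, hx⟩ := h.exists_vtx_P hQ (k := i + 1 + m) (by omega) (by omega)
      have hcon : G.Consecutive Q (G.vtx Q (i + 1 + m)) a b := by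
        rw [show i + 1 + m = i + m + 1 by omega] at hb ⊢
        exact consecutive_of_dartAt hQ ha hb
      exact hφ.right_sub_right hP hQ hcon hBP (by omega) (by omega) hx
        (hθ _ (by omega) (by omega))
    intro m
    induction m with
    | zero =>
      intro _ b hb
      rw [Finset.sum_range_one]
      exact hstep 0 (by omega) a b ha hb
    | succ m ih =>
      intro hm b hb
      obtain ⟨b', hb'⟩ := exists_dartAt (P := Q) (k := i + 1 + m) (by omega)
      rw [Finset.sum_range_succ, ← ih (by omega) b' hb', ← hstep (m + 1) hm b' b
        (by rwa [show i + (m + 1) = i + 1 + m by omega]) hb]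
      ring
  rw [hsum L le_rfl b hb, Finset.sum_sub_distrib]
  congr 1
  · obtain ⟨k, hk1, hk2, hk⟩ := h.exists_vtx_Q hP hQ (a := C + L) (by omega) le_rfl
    rw [Finset.sum_eq_single (k - (i + 1))]
    · rw [Nat.add_sub_cancel' hk1, hk]
    · intro r hr hne
      rw [Finset.mem_range] at hr
      refine if_neg ?_
      obtain ⟨x, h1, h2, hx⟩ := h.exists_vtx_P hQ (k := i + 1 + r) (by omega) (by omega)
      have hxL : x ≠ C + L := by
        rintro rfl
        have := hQ.inj (by omega) (by omega) (hk.trans hx)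
        omega
      obtain ⟨e, he⟩ := exists_dartAt (P := P) (k := x) (by omega)
      exact not_leavesRight_of_mem hP hQ he.mem ((hP.tail he).trans hx)
        (run_mem hsymm.run he h1 (by omega))
    · intro hr
      rw [Finset.mem_range] at hr
      omega
  · obtain ⟨k, hk1, hk2, hk⟩ := h.exists_vtx_Q hP hQ (a := C) le_rfl (by omega)
    rw [Finset.sum_eq_single (k - (i + 1))]
    · rw [Nat.add_sub_cancel' hk1, hk]
    · intro r hr hne
      rw [Finset.mem_range] at hr
      refine if_neg ?_
      obtain ⟨x, h1, h2, hx⟩ := h.exists_vtx_P hQ (k := i + 1 + r) (by omega) (by omega)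
      have hxC : x ≠ C := by
        rintro rfl
        have := hQ.inj (by omega) (by omega) (hk.trans hx)
        omega
      obtain ⟨e, he⟩ := exists_dartAt (P := P) (k := x - 1) (by omega)
      refine not_entersRight_of_mem hP hQ he.mem ?_ (run_mem hsymm.run he (by omega) (by omega))
      rw [he.head, Nat.sub_add_cancel (by omega), hx]
    · intro hr
      rw [Finset.mem_range] at hr
      omega

/-- At a component that is not a crossing, `P` leaves `Q` on the side from which it enters. -/
theorem IsComponent.leavesRight_iff (hP : G.IsSimplePath s t P) (hQ : G.IsSimplePath s t Q)
    {i C L : ℕ} (h : G.IsComponent P Q i C L) (hi : 0 < i) (hiL : i + L < Q.darts.length)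
    (hC : 0 < C) (hCL : C + L < P.darts.length) (hn : ¬ G.CrossesAt P Q i C L) :
    G.LeavesRight P Q (G.vtx P (C + L)) ↔ G.EntersRight P Q (G.vtx P C) := by
  have hsymm := h.symm hP hQ
  obtain ⟨e, he⟩ := exists_dartAt (P := P) (k := C - 1) (by omega)
  obtain ⟨e', he'⟩ := exists_dartAt (P := P) (k := C + L) (by omega)
  have h1 := hsymm.before _ e (by omega) he
  have h2 := hsymm.after _ he'
  obtain ⟨k, hk1, hk2, hk⟩ := h.exists_vtx_Q hP hQ (a := C) le_rfl (by omega)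
  obtain ⟨k', hk1', hk2', hk'⟩ := h.exists_vtx_Q hP hQ (a := C + L) (by omega) le_rfl
  obtain ⟨a, b, -, -, hab⟩ := hQ.exists_consecutive (k := k) (by omega) (by omega)
  obtain ⟨a', b', -, -, hab'⟩ := hQ.exists_consecutive (k := k') (by omega) (by omega)
  rw [hk] at hab
  rw [hk'] at hab'
  have h3 := entersLeft_iff_not hP hQ hab he.mem
    (by rw [he.head, Nat.sub_add_cancel hC]) h1.1 h1.2
  have h4 := leavesLeft_iff_not hP hQ hab' he'.mem (hP.tail he') h2.1 h2.2
  have h5 : ¬ (G.EntersRight P Q (G.vtx P C) ∧ G.LeavesLeft P Q (G.vtx P (C + L)) ∨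
      G.EntersLeft P Q (G.vtx P C) ∧ G.LeavesRight P Q (G.vtx P (C + L))) := fun h' => hn ⟨h, h'⟩
  tauto

/-- Let `θ` be a circulation that, at the vertices of `Q` after vertex `k`, consists of one unit of
flow along the part of `P` between the vertices `A` and `B`, both of which lie on `Q` up to vertex
`k`. If no crossing of `Q` after vertex `k` lies on that part of `P`, then the potential vanishes to
the right of every dart of `Q` from vertex `k` on that is not on an edge of that part of `P`: it
vanishes around `t`, and going back along `Q` it returns to zero after every shared subpath. -/
theorem IsPotential.right_eq_zero {φ : F → ℤ} {θ : D → ℤ} (hφ : G.IsPotential φ θ)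
    {fInf : F} (h0 : φ fInf = 0) (hfInf : ∃ d, G.tail d = t ∧ G.right d = fInf)
    (hP : G.IsSimplePath s t P) (hQ : G.IsSimplePath s t Q) {A B k : ℕ}
    (hB : B ≤ P.darts.length) (hk : k < Q.darts.length)
    (hvA : ∃ r ≤ k, G.vtx Q r = G.vtx P A) (hvB : ∃ r ≤ k, G.vtx Q r = G.vtx P B)
    (hθ : ∀ r, k < r → r ≤ Q.darts.length → ∀ d, G.tail d = G.vtx Q r →
      θ d = G.flow (G.subpath P A B).darts d)
    (hcross : ∀ i C L, k < i → G.CrossesAt P Q i C L → ¬ (A < C ∧ C + L < B))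
    (n : ℕ) : ∀ i d, Q.darts.length - i = n → k ≤ i → DartAt Q i d →
      d ∉ (G.subpath P A B).darts → G.rev d ∉ (G.subpath P A B).darts → φ (G.right d) = 0 := by
  classical
  induction n using Nat.strong_induction_on with
  | _ n ih =>
    intro i d hn hki hd hd1 hd2
    have hdlt := hd.lt
    have hstrict : ∀ r, k < r → r ≤ Q.darts.length → ∀ x, A ≤ x → x ≤ B →
        G.vtx P x = G.vtx Q r → A < x ∧ x < B := by
      intro r hr hrQ x hA hxB hx
      obtain ⟨r1, hr1, e1⟩ := hvA
      obtain ⟨r2, hr2, e2⟩ := hvB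
      refine ⟨lt_of_le_of_ne hA ?_, lt_of_le_of_ne hxB ?_⟩
      · rintro rfl
        have := hQ.inj (by omega) hrQ (e1.trans hx)
        omega
      · rintro rfl
        have := hQ.inj (by omega) hrQ (e2.trans hx)
        omega
    have ht : ∀ x, A ≤ x → x ≤ B → G.vtx P x ≠ t := by
      intro x hA hxB hx
      have h1 := hstrict _ hk le_rfl x hA hxB (hx.trans hQ.vtx_length.symm)
      have h2 := hP.inj (by omega) le_rfl (hx.trans hP.vtx_length.symm)
      omega
    by_cases hv : ∀ x, A ≤ x → x ≤ B → G.vtx P x ≠ G.vtx Q (i + 1)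
    · have hzero : ∀ d', G.tail d' = G.vtx Q (i + 1) → θ d' = 0 := fun d' hd' => by
        rw [hθ (i + 1) (by omega) hdlt d' hd', flow_subpath_eq_zero hP hv hd']
      rcases Nat.eq_or_lt_of_le (Nat.succ_le_of_lt hdlt) with hi | hi
      · obtain ⟨dt, hdt, rfl⟩ := hfInf
        have hiv : G.vtx Q (i + 1) = t := by rw [show i + 1 = _ from hi, hQ.vtx_length]
        have htail : G.tail (G.rev d) = G.vtx Q (i + 1) := hd.head
        have h1 := hφ.eq_of_tail_eq (x := G.rev d) (z := dt)
          (by rw [htail, hiv, hdt]) (fun d' hd' => hzero d' (hd'.trans htail))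
        have h2 := hzero _ htail
        rw [hφ, G.rev_rev] at h2
        omega
      · obtain ⟨b, hb⟩ := exists_dartAt (P := Q) (k := i + 1) hi
        have hab := consecutive_of_dartAt hQ hd hb
        rw [hφ.right_eq hQ hab fun d' hd' => hzero d' (hd'.tail_eq.symm.trans hab.2.2)]
        refine ih _ (by omega) (i + 1) b rfl (by omega) hb ?_ ?_ <;> rw [mem_subpath] <;>
          rintro ⟨m, h1, h2, h3⟩
        · exact hv m h1 h2.le (by rw [← hP.tail h3, hab.2.2])
        · refine hv (m + 1) (by omega) h2 ?_
          rw [← h3.head, PlaneGraph.head, G.rev_rev, hab.2.2]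
    · push Not at hv
      obtain ⟨x, hAx, hxB, hx⟩ := hv
      obtain ⟨hAx', hxB'⟩ := hstrict _ (by omega) hdlt x hAx hxB hx
      -- the run of edges shared with `P` that starts at vertex `i + 1` of `Q`
      have hex : ∃ L, ¬ ∃ d, DartAt Q (i + 1 + L) d ∧ (d ∈ P.darts ∨ G.rev d ∈ P.darts) :=
        ⟨Q.darts.length, by rintro ⟨d, hd, -⟩; have := hd.lt; omega⟩
      obtain ⟨L, hL, hLmin⟩ : ∃ L,
          (¬ ∃ d, DartAt Q (i + 1 + L) d ∧ (d ∈ P.darts ∨ G.rev d ∈ P.darts)) ∧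
          ∀ r < L, ∃ d, DartAt Q (i + 1 + r) d ∧ (d ∈ P.darts ∨ G.rev d ∈ P.darts) :=
        ⟨Nat.find hex, Nat.find_spec hex, fun r hr => not_not.1 (Nat.find_min hex hr)⟩
      have hiL : i + 1 + L ≤ Q.darts.length := by
        rcases Nat.eq_zero_or_pos L with rfl | h
        · exact hdlt
        · obtain ⟨e, he, -⟩ := hLmin (L - 1) (by omega)
          have := he.lt
          omega
      obtain ⟨C, hC⟩ := exists_run hP hQ (L := L) (a := x) (by omega) hx hiL (fun r hr e he => by
        obtain ⟨e', he', h⟩ := hLmin r hr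
        rwa [he.eq he'])
      have hcomp : G.IsComponent P Q (i + 1) C L := by
        refine ⟨hC, ?_, ?_⟩
        · intro k' d' hk' hd'
          obtain rfl : k' = i := by omega
          obtain rfl := hd'.eq hd
          constructor <;> intro hm <;> obtain ⟨m, hm⟩ := exists_dartAt_of_mem hm
          · have := hP.index_of_head hm (j := x) (by omega) (by rw [hd.head, hx])
            exact hd1 (mem_subpath.2 ⟨m, by omega, by omega, hm⟩)
          · obtain rfl := hP.index_of_tail hm (j := x) (by omega) (by
              rw [hx, ← hd.head]; rfl)
            exact hd2 (mem_subpath.2 ⟨m, by omega, by omega, hm⟩)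
        · intro d' hd'
          rw [← not_or]
          exact fun h => hL ⟨d', hd', h⟩
      have hCP := hcomp.le_P
      -- the component lies strictly between the vertices `A` and `B` of `P`
      have hin : ∀ y, C ≤ y → y ≤ C + L → A ≤ y → y ≤ B → A < y ∧ y < B := by
        intro y h1 h2 h3 h4
        obtain ⟨r, hr1, hr2, hr⟩ := hcomp.exists_vtx_Q hP hQ h1 h2
        exact hstrict r (by omega) (by omega) y h3 h4 hr.symm
      obtain ⟨y, hy1, hy2, hy⟩ := hcomp.exists_vtx_P hQ (k := i + 1) le_rfl (by omega)
      obtain rfl := hP.inj (by omega) (by omega) (hy.trans hx.symm)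
      have hAC : A < C := by
        by_contra hcon
        have := hin A (by omega) (by omega) le_rfl (by omega)
        omega
      have hCB : C + L < B := by
        by_contra hcon
        have := hin B (by omega) (by omega) (by omega) le_rfl
        omega
      have hiL' : i + 1 + L < Q.darts.length := by
        refine lt_of_le_of_ne hiL fun heq => ?_
        obtain ⟨z, hz1, hz2, hz⟩ := hcomp.exists_vtx_P hQ (k := i + 1 + L) (by omega) le_rfl
        exact ht z (by omega) (by omega) (by rw [hz, heq, hQ.vtx_length])
      obtain ⟨b, hb⟩ := exists_dartAt (P := Q) (k := i + 1 + L) hiL'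
      have hflux := hcomp.right_sub_right hφ hP hQ hAC hCB hB
        (fun r h1 h2 => hθ r (by omega) (by omega)) hd hb
      have hiff := hcomp.leavesRight_iff hP hQ (by omega) hiL' (by omega) (by omega)
        (fun h => hcross _ _ _ (by omega) h ⟨hAC, hCB⟩)
      simp only [hiff, sub_self] at hflux
      have hbP := hcomp.after b hb
      have := ih _ (by omega) (i + 1 + L) b rfl (by omega) hb
        (fun h => hbP.1 (subpath_subset P A B h)) (fun h => hbP.2 (subpath_subset P A B h))
      omega

end PlaneGraph

namespace PlaneGraph

variable {V D F : Type*} [Fintype V] [Fintype D] [Fintype F] {G : PlaneGraph V D F}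
  {s t : V} {P Q : DartPath V D} {fInf : F} {c : D → ℝ}

/-! ### Directions and order of the crossings -/

theorem IsSimplePath.isWalk_subpath (hP : G.IsSimplePath s t P) {i j : ℕ} (hij : i ≤ j)
    (hj : j ≤ P.darts.length) :
    G.IsWalk (G.vtx P i) (G.subpath P i j).darts (G.vtx P j) := by
  obtain ⟨k, rfl⟩ := Nat.exists_eq_add_of_le hij
  clear hij
  induction k with
  | zero =>
    have : (G.subpath P i (i + 0)).darts = [] := by simp [subpath]
    rw [this]
    exact rfl
  | succ k ih =>
    obtain ⟨d, hd⟩ := exists_dartAt (P := P) (k := i + k) (by omega)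
    have : (G.subpath P i (i + (k + 1))).darts = (G.subpath P i (i + k)).darts ++ [d] := by
      have h1 : P.darts[i + k]? = some d := hd
      simp only [subpath]
      rw [← Nat.add_assoc, List.take_add_one, h1, List.drop_append_of_le_length]
      · rfl
      · have := hd.lt
        simp; omega
    rw [this]
    exact (ih (by omega)).append _ ⟨hP.tail hd, hd.head⟩

theorem flow_eq_add_add (P : DartPath V D) {a b : ℕ} (hab : a ≤ b) (d : D) :
    G.flow P.darts d = G.flow (G.subpath P 0 a).darts d + G.flow (G.subpath P a b).darts d +
      G.flow (G.subpath P b P.darts.length).darts d := by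
  rw [← flow_append, ← flow_append]
  congr 1
  simp only [subpath, List.drop_zero, List.take_length]
  rw [show P.darts.take a = (P.darts.take b).take a by rw [List.take_take, min_eq_left hab],
    List.take_append_drop, List.take_append_drop]

theorem outflow_add (θ η : D → ℤ) (v : V) :
    G.outflow (fun d => θ d + η d) v = G.outflow θ v + G.outflow η v := by
  simp [outflow, Finset.sum_add_distrib]

theorem pos_of_rev_mem (hQrev : Residual c (G.revPath Q).darts) {d : D} (h : G.rev d ∈ Q.darts) :
    0 < c d := by
  refine hQrev d ?_
  simp only [revPath, List.mem_reverse, List.mem_map]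
  exact ⟨_, h, G.rev_rev d⟩

/-- If all crossings after a component along `Q` come after it along `P` too, then `P` does not
enter `Q` from the left at this component: otherwise `P` up to the component and back along the
reverse of `Q` would form a residual circulation whose potential is positive to the left of `Q`. -/
theorem not_entersLeft (hfInf : ∃ d, G.tail d = t ∧ G.right d = fInf)
    (hc : G.ClockwiseAcyclic fInf c) (hP : G.IsSimplePath s t P) (hPres : Residual c P.darts)
    (hQ : G.IsSimplePath s t Q) (hQrev : Residual c (G.revPath Q).darts) {i A L : ℕ}
    (h : G.IsComponent P Q i A L)
    (hlater : ∀ j B M, i < j → G.CrossesAt P Q j B M → A + L < B) :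
    ¬ G.EntersLeft P Q (G.vtx P A) := by
  classical
  rintro ⟨e, he, a, b, hab, ha, hb, hev, hcw⟩
  have hcon : G.Consecutive Q (G.vtx P A) a b := ⟨hab, ha, hb⟩
  obtain ⟨k, hka, hkb⟩ := pair_infix_iff.1 hab
  have hk := hkb.lt
  have hAP := h.le_P
  have hvk : G.vtx Q (k + 1) = G.vtx P A := hka.head.symm.trans ha
  have hik : i ≤ k + 1 := by
    obtain ⟨k', h1, h2, h3⟩ := h.exists_vtx_Q hP hQ (a := A) le_rfl (by omega)
    have := hQ.inj (by have := h.le_Q; omega) hk.le (h3.trans hvk.symm)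
    omega
  have htab : G.tail b = G.tail (G.rev a) := hb.trans ha.symm
  have hne := hcon.ne_rev hQ
  -- the circulation along `P` to the crossing and back along `Q`
  let θ : D → ℤ := fun d =>
    G.flow (G.subpath P 0 A).darts d - G.flow (G.subpath Q 0 (k + 1)).darts d
  have hwP := hP.isWalk_subpath (Nat.zero_le A) (by omega)
  have hwQ := hQ.isWalk_subpath (Nat.zero_le (k + 1)) hk.le
  have h0 : G.vtx Q 0 = G.vtx P 0 := by rw [hQ.vtx_zero_eq, hP.vtx_zero_eq]
  obtain ⟨φ, hφ0, hφ⟩ := G.exists_potential fInf (θ := θ)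
    (fun d => by simp only [θ, flow_rev]; ring)
    (fun v => by rw [G.outflow_sub, G.outflow_flow hwP, G.outflow_flow hwQ, h0, hvk, sub_self])
  have hneg := hc.potential_nonpos hφ0 hφ (fun d hd => by
    by_cases h1 : 0 < G.flow (G.subpath P 0 A).darts d
    · exact hPres d (subpath_subset P _ _ (G.flow_pos h1))
    · have h2 : 0 < G.flow (G.subpath Q 0 (k + 1)).darts (G.rev d) := by
        rw [flow_rev]
        simp only [θ] at hd
        omega
      exact pos_of_rev_mem hQrev (subpath_subset Q _ _ (G.flow_pos h2)))
  have hright : φ (G.right b) = 0 := by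
    refine hφ.right_eq_zero hφ0 hfInf hP hQ (A := 0) (B := A) (k := k + 1) (by omega) hk
      ⟨0, by omega, h0⟩ ⟨k + 1, le_rfl, hvk⟩ ?_ ?_ _ (k + 1) b rfl le_rfl hkb ?_ ?_
    · intro r hr hrQ d hd
      have : G.flow (G.subpath Q 0 (k + 1)).darts d = 0 :=
        flow_subpath_eq_zero hQ (fun x _ hx heq => by
          have := hQ.inj (by omega) hrQ heq
          omega) hd
      simp only [θ, this, sub_zero]
    · rintro j B M hj hcr ⟨-, hBA⟩
      have := hlater j B M (by omega) hcr
      omega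
    · rw [mem_subpath]
      rintro ⟨m, -, hm, hmb⟩
      have := hP.index_of_tail hmb (j := A) (by omega) hb
      omega
    · intro hm
      have h1 := hP.eq_of_head_eq (subpath_subset P _ _ hm) he
        (by rw [PlaneGraph.head, G.rev_rev, hb, hev])
      rw [← h1, G.rev_rev] at hcw
      exact hcw.ne_right rfl
  have hrighta : φ (G.right a) = 0 := by
    rw [hφ.right_eq hQ hcon, hright]
    intro d hd
    have htd := hd.tail_eq.symm.trans hb
    have hdQ := not_mem_of_cwOrder hQ hcon hd
    have h1 : G.flow (G.subpath Q 0 (k + 1)).darts d = 0 :=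
      G.flow_eq_zero (fun h => hdQ.1 (subpath_subset Q _ _ h))
        (fun h => hdQ.2 (subpath_subset Q _ _ h))
    have h2 : G.flow (G.subpath P 0 A).darts d = 0 := by
      refine G.flow_eq_zero ?_ ?_
      · rw [mem_subpath]
        rintro ⟨m, -, hm, hmd⟩
        have := hP.index_of_tail hmd (j := A) (by omega) htd
        omega
      · intro hm
        have h1 := hP.eq_of_head_eq (subpath_subset P _ _ hm) he
          (by rw [PlaneGraph.head, G.rev_rev, htd, hev])
        rw [← h1, G.rev_rev] at hcw
        exact hd.not_reverse htab hne hcw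
    simp only [θ, h1, h2, sub_zero]
  have hθa : θ a = -1 := by
    have h1 : G.flow (G.subpath Q 0 (k + 1)).darts a = 1 :=
      G.flow_eq_one (nodup_subpath hQ _ _) (mem_subpath.2 ⟨k, by omega, by omega, hka⟩)
        (fun h => hQ.rev_not_mem hka.mem (subpath_subset Q _ _ h))
    have h2 : G.flow (G.subpath P 0 A).darts a = 0 := by
      refine G.flow_eq_zero ?_ ?_
      · intro hm
        have h1 := hP.eq_of_head_eq (subpath_subset P _ _ hm) he (ha.trans hev.symm)
        rw [← h1] at hcw
        exact hcw.ne_left htab.symm rfl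
      · rw [mem_subpath]
        rintro ⟨m, -, hm, hmd⟩
        have := hP.index_of_tail hmd (j := A) (by omega) ha
        omega
    simp only [θ, h1, h2, zero_sub]
  have h1 := hφ a
  have h2 := hneg (G.right (G.rev a))
  omega

/-- Suppose that the component at `j`, `B`, `M` comes after the component at `i`, `A`, `L` along
`Q` but before it along `P`. If all crossings even later along `Q` come after the component at `i`
along `P`, then `P` does not leave `Q` to the left at `j`: otherwise replacing the part of `P`
between the two by the reverse of a part of `Q` would yield a residual flow whose potential
relative to `P` is positive somewhere. -/
theorem not_leavesLeft (hfInf : ∃ d, G.tail d = t ∧ G.right d = fInf)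
    (hc : G.ClockwiseAcyclic fInf c) (hP : G.IsLeftmostResidual fInf c s t P)
    (hQ : G.IsSimplePath s t Q) (hQrev : Residual c (G.revPath Q).darts) {i A L j B M : ℕ}
    (h : G.IsComponent P Q i A L) (h' : G.IsComponent P Q j B M) (hij : i < j)
    (hBA : B + M < A)
    (hlater : ∀ k C N, j < k → G.CrossesAt P Q k C N → A + L < C) :
    ¬ G.LeavesLeft P Q (G.vtx P (B + M)) := by
  classical
  have hPs := hP.1
  rintro ⟨e, he, a, b, hab, ha, hb, hev, hcw⟩
  have hcon : G.Consecutive Q (G.vtx P (B + M)) a b := ⟨hab, ha, hb⟩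
  obtain ⟨k, hka, hkb⟩ := pair_infix_iff.1 hab
  have hk := hkb.lt
  have hAP := h.le_P
  have hBP := h'.le_P
  have hvk : G.vtx Q (k + 1) = G.vtx P (B + M) := hka.head.symm.trans ha
  have hjk : j ≤ k + 1 := by
    obtain ⟨k', h1, h2, h3⟩ := h'.exists_vtx_Q hPs hQ (a := B + M) (by omega) le_rfl
    have := hQ.inj (by have := h'.le_Q; omega) hk.le (h3.trans hvk.symm)
    omega
  obtain ⟨r, hr1, hr2, hr⟩ := h.exists_vtx_Q hPs hQ (a := A) le_rfl (by omega)
  have hrk : r < k + 1 := by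
    have := h.lt_of_lt h' hij
    omega
  have htab : G.tail b = G.tail (G.rev a) := hb.trans ha.symm
  have hne := hcon.ne_rev hQ
  -- the circulation along `P` from the later to the earlier crossing of `Q`, and on along `Q`
  let θ : D → ℤ := fun d =>
    G.flow (G.subpath P (B + M) A).darts d + G.flow (G.subpath Q r (k + 1)).darts d
  have hwP := hPs.isWalk_subpath hBA.le (by omega)
  have hwQ := hQ.isWalk_subpath hrk.le hk.le
  obtain ⟨φ, hφ0, hφ⟩ := G.exists_potential fInf (θ := θ)
    (fun d => by simp only [θ, flow_rev]; ring)
    (fun v => by rw [outflow_add, G.outflow_flow hwP, G.outflow_flow hwQ, hr, hvk]; ring)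
  have hpos : ∀ f, 0 ≤ φ f := by
    intro f
    have := hP.potential_nonpos hc (φ := fun f => -φ f) (θ := fun d => -θ d) (by simp [hφ0])
      (fun d => by have := hφ d; beta_reduce; omega)
      (fun d hd => by
        rw [flow_eq_add_add P hBA.le] at hd
        by_cases h1 : 0 < G.flow (G.subpath P 0 (B + M)).darts d
        · exact hP.2.1 d (subpath_subset P _ _ (G.flow_pos h1))
        · by_cases h2 : 0 < G.flow (G.subpath P A P.darts.length).darts d
          · exact hP.2.1 d (subpath_subset P _ _ (G.flow_pos h2))
          · have h3 : 0 < G.flow (G.subpath Q r (k + 1)).darts (G.rev d) := by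
              rw [flow_rev]
              simp only [θ] at hd
              omega
            exact pos_of_rev_mem hQrev (subpath_subset Q _ _ (G.flow_pos h3))) f
    omega
  have hright : φ (G.right b) = 0 := by
    refine hφ.right_eq_zero hφ0 hfInf hPs hQ (A := B + M) (B := A) (k := k + 1) (by omega) hk
      ⟨k + 1, le_rfl, hvk⟩ ⟨r, hrk.le, hr⟩ ?_ ?_ _ (k + 1) b rfl le_rfl hkb ?_ ?_
    · intro m hm hmQ d hd
      have : G.flow (G.subpath Q r (k + 1)).darts d = 0 :=
        flow_subpath_eq_zero hQ (fun x _ hx heq => by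
          have := hQ.inj (by omega) hmQ heq
          omega) hd
      simp only [θ, this, add_zero]
    · rintro m C N hm hcr ⟨-, hCN⟩
      have := hlater m C N (by omega) hcr
      omega
    · intro hm
      have h1 := hPs.eq_of_tail_eq (subpath_subset P _ _ hm) he (hb.trans hev.symm)
      exact hcw.ne_right h1.symm
    · rw [mem_subpath]
      rintro ⟨m, hm, -, hmb⟩
      have := hPs.index_of_head hmb (j := B + M) (by omega)
        (by rw [PlaneGraph.head, G.rev_rev, hb])
      omega
  have hrighta : φ (G.right a) = 0 := by
    rw [hφ.right_eq hQ hcon, hright]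
    intro d hd
    have htd := hd.tail_eq.symm.trans hb
    have hdQ := not_mem_of_cwOrder hQ hcon hd
    have h1 : G.flow (G.subpath Q r (k + 1)).darts d = 0 :=
      G.flow_eq_zero (fun h => hdQ.1 (subpath_subset Q _ _ h))
        (fun h => hdQ.2 (subpath_subset Q _ _ h))
    have h2 : G.flow (G.subpath P (B + M) A).darts d = 0 := by
      refine G.flow_eq_zero ?_ ?_
      · intro hm
        have h1 := hPs.eq_of_tail_eq (subpath_subset P _ _ hm) he (htd.trans hev.symm)
        rw [← h1] at hcw
        exact hd.not_reverse htab hne hcw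
      · rw [mem_subpath]
        rintro ⟨m, hm, -, hmd⟩
        have := hPs.index_of_head hmd (j := B + M) (by omega)
          (by rw [PlaneGraph.head, G.rev_rev, htd])
        omega
    simp only [θ, h1, h2, add_zero]
  have hθa : θ a = 1 := by
    have h1 : G.flow (G.subpath Q r (k + 1)).darts a = 1 :=
      G.flow_eq_one (nodup_subpath hQ _ _) (mem_subpath.2 ⟨k, by omega, by omega, hka⟩)
        (fun h => hQ.rev_not_mem hka.mem (subpath_subset Q _ _ h))
    have h2 : G.flow (G.subpath P (B + M) A).darts a = 0 := by
      refine G.flow_eq_zero ?_ ?_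
      · rw [mem_subpath]
        rintro ⟨m, hm, -, hmd⟩
        have := hPs.index_of_head hmd (j := B + M) (by omega) ha
        omega
      · intro hm
        have h1 := hPs.eq_of_tail_eq (subpath_subset P _ _ hm) he
          (show G.head a = _ from ha.trans hev.symm)
        rw [← h1] at hcw
        exact hcw.ne_left htab.symm rfl
    simp only [θ, h1, h2, zero_add]
  have h1 := hφ a
  have h2 := hpos (G.right (G.rev a))
  omega

/-- Two different components are disjoint intervals of `P`. -/
theorem IsComponent.lt_or_lt (hP : G.IsSimplePath s t P) (hQ : G.IsSimplePath s t Q)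
    {i A L j B M : ℕ} (h : G.IsComponent P Q i A L) (h' : G.IsComponent P Q j B M) (hij : i < j) :
    A + L < B ∨ B + M < A := by
  rcases lt_trichotomy A B with hAB | rfl | hAB
  · exact Or.inl ((h.symm hP hQ).lt_of_lt (h'.symm hP hQ) hAB)
  · obtain ⟨r, hr1, hr2, hr⟩ := h.exists_vtx_Q hP hQ (a := A) le_rfl (by omega)
    obtain ⟨r', hr1', hr2', hr'⟩ := h'.exists_vtx_Q hP hQ (a := A) le_rfl (by omega)
    have h1 := hQ.inj (by have := h.le_Q; omega) (by have := h'.le_Q; omega) (hr.trans hr'.symm)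
    have h2 := h.lt_of_lt h' hij
    omega
  · exact Or.inr ((h'.symm hP hQ).lt_of_lt (h.symm hP hQ) hAB)

/-- The crossings occur in the same order along `P` as along `Q`. -/
theorem CrossesAt.lt_of_lt (hfInf : ∃ d, G.tail d = t ∧ G.right d = fInf)
    (hc : G.ClockwiseAcyclic fInf c) (hP : G.IsLeftmostResidual fInf c s t P)
    (hQ : G.IsSimplePath s t Q) (hQrev : Residual c (G.revPath Q).darts) (n : ℕ) :
    ∀ {i A L}, Q.darts.length - i = n → G.CrossesAt P Q i A L →
      ∀ j B M, i < j → G.CrossesAt P Q j B M → A + L < B := by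
  induction n using Nat.strong_induction_on with
  | _ n ih =>
    intro i A L hn h
    have key : ∀ m j, Q.darts.length - j = m → ∀ B M, i < j → G.CrossesAt P Q j B M →
        A + L < B := by
      intro m
      induction m using Nat.strong_induction_on with
      | _ m ih' =>
        intro j hm B M hij h'
        have hjQ := h'.1.le_Q
        rcases h.1.lt_or_lt hP.1 hQ h'.1 hij with hlt | hlt
        · exact hlt
        · exfalso
          have h1 := not_leavesLeft hfInf hc hP hQ hQrev h.1 h'.1 hij hlt
            (fun k C N hjk hcr => ih' _ (by have := hcr.1.le_Q; omega) k rfl C N (by omega) hcr)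
          have h2 := not_entersLeft hfInf hc hP.1 hP.2.1 hQ hQrev h'.1
            (ih _ (by omega) rfl h')
          rcases h'.2 with h3 | h3
          · exact h1 h3.2
          · exact h2 h3.1
    exact fun j B M => key _ j rfl B M

/-- Every crossing is from right to left. -/
theorem CrossesAt.entersRight (hfInf : ∃ d, G.tail d = t ∧ G.right d = fInf)
    (hc : G.ClockwiseAcyclic fInf c) (hP : G.IsLeftmostResidual fInf c s t P)
    (hQ : G.IsSimplePath s t Q) (hQrev : Residual c (G.revPath Q).darts) {i A L : ℕ}
    (h : G.CrossesAt P Q i A L) :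
    G.EntersRight P Q (G.vtx P A) ∧ G.LeavesLeft P Q (G.vtx P (A + L)) := by
  have h2 := not_entersLeft hfInf hc hP.1 hP.2.1 hQ hQrev h.1
    (CrossesAt.lt_of_lt hfInf hc hP hQ hQrev _ rfl h)
  rcases h.2 with h3 | h3
  · exact h3
  · exact absurd h3.1 h2

end PlaneGraph

namespace PlaneGraph

variable {V D F : Type*} [Fintype V] [Fintype D] [Fintype F] {G : PlaneGraph V D F}
  {s t : V} {P Q : DartPath V D}

/-! ### Exchanging the two paths -/

theorem CwOrder.rotate {x y z : D} (h : G.CwOrder x y z) (hz : G.tail x = G.tail z)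
    (hxz : x ≠ z) : G.CwOrder y z x :=
  (cwOrder_rotate h.tail_eq hz (h.ne_left hz) hxz).1 h

theorem CwOrder.rotate_right {x y z : D} (h : G.CwOrder x y z) (hz : G.tail x = G.tail z)
    (hxz : x ≠ z) : G.CwOrder z x y :=
  (h.rotate hz hxz).rotate h.tail_eq.symm (h.ne_left hz).symm

/-- A crossing of `Q` by `P` is a crossing of `P` by `Q`, in the other direction. -/
theorem CrossesAt.symm {i A L : ℕ} (h : G.CrossesAt P Q i A L) (hP : G.IsSimplePath s t P)
    (hQ : G.IsSimplePath s t Q) : G.CrossesAt Q P A i L := by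
  have hsymm := h.1.symm hP hQ
  have hAP := h.1.le_P
  have hiQ := h.1.le_Q
  obtain ⟨e, a, b, he, hev, hab⟩ : ∃ e a b, e ∈ P.darts ∧ G.head e = G.vtx P A ∧
      G.Consecutive Q (G.vtx P A) a b := by
    rcases h.2 with ⟨⟨e, he, a, b, hab, h1, h2, h3, -⟩, -⟩ |
      ⟨⟨e, he, a, b, hab, h1, h2, h3, -⟩, -⟩ <;>
      exact ⟨e, a, b, he, h3, hab, h1, h2⟩
  obtain ⟨e', a', b', he', hev', hab'⟩ : ∃ e a b, e ∈ P.darts ∧ G.tail e = G.vtx P (A + L) ∧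
      G.Consecutive Q (G.vtx P (A + L)) a b := by
    rcases h.2 with ⟨-, ⟨e, he, a, b, hab, h1, h2, h3, -⟩⟩ |
      ⟨-, ⟨e, he, a, b, hab, h1, h2, h3, -⟩⟩ <;>
      exact ⟨e, a, b, he, h3, hab, h1, h2⟩
  obtain ⟨m, hm⟩ := exists_dartAt_of_mem he
  have hmA := hP.index_of_head hm (j := A) (by omega) hev
  obtain ⟨m', hm'⟩ := exists_dartAt_of_mem he'
  obtain rfl := hP.index_of_tail hm' hAP hev'
  obtain ⟨p, hp⟩ := exists_dartAt (P := P) (k := A) (by have := hm'.lt; omega)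
  obtain ⟨p', hp'⟩ := exists_dartAt (P := P) (k := A + L - 1) (by omega)
  have hep : G.Consecutive P (G.vtx P A) e p := by
    subst hmA
    exact consecutive_of_dartAt hP hm hp
  have hep' : G.Consecutive P (G.vtx P (A + L)) p' e' := by
    have h1 := consecutive_of_dartAt hP (k := A + L - 1) (a := p') (b := e') hp'
    rw [Nat.sub_add_cancel (by omega)] at h1
    exact h1 hm'
  have hne := hab.ne_rev hQ
  have hne' := hab'.ne_rev hQ
  have htl : G.tail b = G.tail (G.rev a) := hab.2.2.trans hab.2.1.symm
  have htl' : G.tail b' = G.tail (G.rev a') := hab'.2.2.trans hab'.2.1.symm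
  have hER := entersRight_iff hP hQ hab he hev
  have hEL := entersLeft_iff hP hQ hab he hev
  have hLR := leavesRight_iff hP hQ hab' he' hev'
  have hLL := leavesLeft_iff hP hQ hab' he' hev'
  refine ⟨hsymm, ?_⟩
  have h2 := h.2
  rw [hER, hEL, hLR, hLL] at h2
  rcases Nat.eq_zero_or_pos L with rfl | hL
  · have hv : G.vtx Q i = G.vtx P A := by
      rcases h.1.run with hr | hr <;> exact hr.2.2.1.symm
    -- `P` and `Q` cross at a single vertex
    obtain rfl : p = e' := hp.eq hm'
    obtain rfl := hQ.eq_of_head_eq hab.mem_left hab'.mem_left (hab.2.1.trans hab'.2.1.symm)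
    obtain rfl := hQ.eq_of_tail_eq hab.mem_right hab'.mem_right (hab.2.2.trans hab'.2.2.symm)
    simp only [Nat.add_zero] at h2 ⊢
    rw [hv, entersRight_iff hQ hP hep hab.mem_left hab.2.1,
      entersLeft_iff hQ hP hep hab.mem_left hab.2.1,
      leavesRight_iff hQ hP hep hab.mem_right hab.2.2,
      leavesLeft_iff hQ hP hep hab.mem_right hab.2.2]
    have hte : G.tail b = G.tail (G.rev e) := hab.2.2.trans hev.symm
    have htp : G.tail b = G.tail p := hab.2.2.trans hep.2.2.symm
    rcases h2 with ⟨h1, h2⟩ | ⟨h1, h2⟩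
    · exact Or.inr (cwOrder_interlace hte htl htp hne h1 h2)
    · exact Or.inl (cwOrder_interlace (htl.symm.trans hte) htl.symm (htl.symm.trans htp) hne.symm
        h1 h2).symm
  · rcases h.1.run with hr | hr
    · have hv : G.vtx Q i = G.vtx P A := hr.2.2.1.symm
      have hv' : G.vtx Q (i + L) = G.vtx P (A + L) := (hr.vtx_eq le_rfl).symm
      have hbp : b = p := by
        refine hP.eq_of_tail_eq ?_ hp.mem (hab.2.2.trans (hP.tail hp).symm)
        obtain ⟨k, hk⟩ := exists_dartAt_of_mem hab.mem_right
        obtain rfl := hQ.index_of_tail hk (j := i) (by omega) (hab.2.2.trans hv.symm)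
        exact hr.mem hk le_rfl (by omega)
      have hap : a' = p' := by
        refine hP.eq_of_head_eq ?_ hp'.mem (hab'.2.1.trans hep'.2.1.symm)
        obtain ⟨k, hk⟩ := exists_dartAt_of_mem hab'.mem_left
        have := hQ.index_of_head hk (j := i + L) (by omega) (hab'.2.1.trans hv'.symm)
        exact hr.mem hk (by omega) (by omega)
      subst hbp hap
      rw [hv, hv', entersRight_iff hQ hP hep hab.mem_left hab.2.1,
        entersLeft_iff hQ hP hep hab.mem_left hab.2.1,
        leavesRight_iff hQ hP hep' hab'.mem_right hab'.2.2,
        leavesLeft_iff hQ hP hep' hab'.mem_right hab'.2.2]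
      rcases h2 with ⟨h1, h2⟩ | ⟨h1, h2⟩
      · exact Or.inr ⟨h1.rotate htl hne, h2.rotate htl'.symm hne'.symm⟩
      · exact Or.inl ⟨h1.rotate_right htl.symm hne.symm, h2.rotate_right htl' hne'⟩
    · have hv : G.vtx Q (i + L) = G.vtx P A := hr.2.2.1.symm
      have hv' : G.vtx Q i = G.vtx P (A + L) := (hr.vtx_eq hQ (r := 0) (Nat.zero_le _)).symm
      have hap : G.rev a = p := by
        refine hP.eq_of_tail_eq ?_ hp.mem (hab.2.1.trans (hP.tail hp).symm)
        obtain ⟨k, hk⟩ := exists_dartAt_of_mem hab.mem_left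
        have := hQ.index_of_head hk (j := i + L) (by omega) (hab.2.1.trans hv.symm)
        exact hr.mem hk (by omega) (by omega)
      have hbp : G.rev p' = b' := by
        rw [← G.rev_rev b']
        congr 1
        refine (hP.eq_of_head_eq ?_ hp'.mem ?_).symm
        · obtain ⟨k, hk⟩ := exists_dartAt_of_mem hab'.mem_right
          obtain rfl := hQ.index_of_tail hk (j := i) (by omega) (hab'.2.2.trans hv'.symm)
          exact hr.mem hk le_rfl (by omega)
        · rw [PlaneGraph.head, G.rev_rev, hab'.2.2, hep'.2.1]
      rw [hv, hv', entersRight_iff hQ hP hep' hab'.mem_left hab'.2.1,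
        entersLeft_iff hQ hP hep' hab'.mem_left hab'.2.1,
        leavesRight_iff hQ hP hep hab.mem_right hab.2.2,
        leavesLeft_iff hQ hP hep hab.mem_right hab.2.2, hbp, ← hap]
      rcases h2 with ⟨h1, h2⟩ | ⟨h1, h2⟩
      · exact Or.inr ⟨h2.rotate_right htl'.symm hne'.symm, h1.rotate_right htl hne⟩
      · exact Or.inl ⟨h2.rotate htl' hne', h1.rotate htl.symm hne.symm⟩

/-! ### The lists of crossings -/

theorem mem_subpaths {X : DartPath V D} : X ∈ G.subpaths Q ↔ G.IsSubpath X Q := by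
  rw [isSubpath_iff]
  simp only [subpaths, List.mem_flatMap, List.mem_map, List.mem_range]
  constructor
  · rintro ⟨i, hi, k, hk, rfl⟩
    exact ⟨i, k, by omega, rfl⟩
  · rintro ⟨i, k, hk, rfl⟩
    exact ⟨i, by omega, k, by omega, rfl⟩

theorem mem_crossings (hP : G.IsSimplePath s t P) (hQ : G.IsSimplePath s t Q)
    {X : DartPath V D} :
    X ∈ G.crossings P Q ↔ ∃ i A L, X = G.subpath Q i (i + L) ∧ G.CrossesAt P Q i A L := by
  simp only [crossings, List.mem_filter, mem_subpaths, decide_eq_true_eq]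
  rw [crosses_iff hP hQ]
  constructor
  · exact fun h => h.2
  · rintro ⟨i, A, L, rfl, h⟩
    exact ⟨isSubpath_iff.2 ⟨i, L, h.1.le_Q, rfl⟩, i, A, L, rfl, h⟩

variable (G) in
/-- `X` and `Y` are subpaths of `Q`, and the first vertex of `X` comes before that of `Y`. -/
def StartsBefore (Q X Y : DartPath V D) : Prop :=
  ∃ i L j M, X = G.subpath Q i (i + L) ∧ Y = G.subpath Q j (j + M) ∧ i + L ≤ Q.darts.length ∧
    j + M ≤ Q.darts.length ∧ i < j

theorem StartsBefore.asymm (hQ : G.IsSimplePath s t Q) {X Y : DartPath V D}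
    (h : G.StartsBefore Q X Y) : ¬ G.StartsBefore Q Y X := by
  obtain ⟨i, L, j, M, rfl, rfl, h1, h2, h3⟩ := h
  rintro ⟨j', M', i', L', e1, e2, h1', h2', h3'⟩
  have := hQ.subpath_inj h2 h1' e1
  have := hQ.subpath_inj h1 h2' e2
  omega

/-- The crossings are listed in the order of their first vertices. -/
theorem crossings_pairwise (hP : G.IsSimplePath s t P) (hQ : G.IsSimplePath s t Q) :
    (G.crossings P Q).Pairwise (G.StartsBefore Q) := by
  have hlex : (G.subpaths Q).Pairwise fun X Y => ∃ i L j M, X = G.subpath Q i (i + L) ∧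
      Y = G.subpath Q j (j + M) ∧ i + L ≤ Q.darts.length ∧ j + M ≤ Q.darts.length ∧
      (i < j ∨ i = j ∧ L < M) := by
    unfold subpaths
    rw [List.pairwise_flatMap]
    constructor
    · intro i hi
      rw [List.mem_range] at hi
      rw [List.pairwise_map]
      refine List.pairwise_lt_range.imp_of_mem fun {L M} hL hM h => ?_
      rw [List.mem_range] at hL hM
      exact ⟨i, L, i, M, rfl, rfl, by omega, by omega, Or.inr ⟨rfl, h⟩⟩
    · refine List.pairwise_lt_range.imp_of_mem fun {i j} _ _ h => ?_
      simp only [List.mem_map, List.mem_range]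
      rintro _ ⟨L, hL, rfl⟩ _ ⟨M, hM, rfl⟩
      exact ⟨i, L, j, M, rfl, rfl, by omega, by omega, Or.inl h⟩
  have hsub : (G.crossings P Q).Sublist (G.subpaths Q) := List.filter_sublist
  refine (hlex.sublist hsub).imp_of_mem fun {X Y} hX hY h => ?_
  obtain ⟨i, L, j, M, rfl, rfl, hi, hj, hlt | ⟨rfl, hlt⟩⟩ := h
  · exact ⟨i, L, j, M, rfl, rfl, hi, hj, hlt⟩
  · obtain ⟨i', A, L', e1, h1⟩ := (mem_crossings hP hQ).1 hX
    obtain ⟨j', B, M', e2, h2⟩ := (mem_crossings hP hQ).1 hY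
    obtain ⟨rfl, rfl⟩ := hQ.subpath_inj hi h1.1.le_Q e1
    obtain ⟨rfl, rfl⟩ := hQ.subpath_inj hj h2.1.le_Q e2
    have := h1.1.length_unique h2.1
    omega

open Classical in
variable (G) in
/-- A subpath shared with `P`, in the direction in which `P` runs along it. -/
noncomputable def orient (P X : DartPath V D) : DartPath V D :=
  if G.IsSubpath X P then X else G.revPath X

theorem IsComponent.orient_eq (hP : G.IsSimplePath s t P) (hQ : G.IsSimplePath s t Q)
    {i A L : ℕ} (h : G.IsComponent P Q i A L) :
    G.orient P (G.subpath Q i (i + L)) = G.subpath P A (A + L) := by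
  unfold orient
  split_ifs with hs
  · obtain ⟨B, M, hB, heq⟩ := isSubpath_iff.1 hs
    rcases h.run with hr | hr
    · exact hr.subpath_eq
    · have hlen := congrArg (fun X : DartPath V D => X.darts.length) heq
      simp only [length_subpath h.le_Q, length_subpath hB] at hlen
      obtain rfl : L = M := by omega
      -- `P` runs along the subpath in both directions, so the subpath is trivial
      have hpar := parallel_of_subpath_eq h.le_Q hB heq
      rcases Nat.eq_zero_or_pos L with rfl | hL
      · have := hP.inj (by omega) (by have := h.le_P; omega) (hpar.2.2.1.trans hr.2.2.1.symm)
        rw [heq, this]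
      · obtain ⟨d, hd⟩ := exists_dartAt (P := Q) (k := i) (by have := h.le_Q; omega)
        exact absurd (hr.mem hd le_rfl (by omega))
          (hP.rev_not_mem (hpar.mem hd le_rfl (by omega)))
  · rcases h.run with hr | hr
    · exact absurd (isSubpath_iff.2 ⟨A, L, hr.2.1, hr.subpath_eq⟩) hs
    · exact hr.subpath_eq hQ

end PlaneGraph

theorem mainTheorem4 {V D F : Type*} [Fintype V] [Fintype D] [Fintype F]
    (G : PlaneGraph V D F) (s t : V) (fInf : F) (hfInf : ∃ d, G.tail d = t ∧ G.right d = fInf)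
    (c : D → ℝ) (hc : G.ClockwiseAcyclic fInf c)
    (P Q : DartPath V D) (hP : G.IsLeftmostResidual fInf c s t P)
    (hQ : G.IsSimplePath s t Q) (hQrev : PlaneGraph.Residual c (G.revPath Q).darts) :
    List.Forall₂ (fun X Y => X = Y ∨ X = G.revPath Y) (G.crossings P Q) (G.crossings Q P) ∧
      ∀ X ∈ G.crossings P Q, G.CrossesRightToLeft P Q X := by
  have hPs := hP.1
  refine ⟨?_, fun X hX => ?_⟩
  · -- both lists are sorted along `P`, and they have the same members up to direction
    have hsorted : ((G.crossings P Q).map (G.orient P)).Pairwise (G.StartsBefore P) := by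
      rw [List.pairwise_map]
      refine (PlaneGraph.crossings_pairwise hPs hQ).imp_of_mem fun {X Y} hX hY h => ?_
      obtain ⟨i, A, L, rfl, h1⟩ := (PlaneGraph.mem_crossings hPs hQ).1 hX
      obtain ⟨j, B, M, rfl, h2⟩ := (PlaneGraph.mem_crossings hPs hQ).1 hY
      obtain ⟨i', L', j', M', e1, e2, hi', hj', hlt⟩ := h
      obtain ⟨rfl, rfl⟩ := hQ.subpath_inj h1.1.le_Q hi' e1
      obtain ⟨rfl, rfl⟩ := hQ.subpath_inj h2.1.le_Q hj' e2
      have := PlaneGraph.CrossesAt.lt_of_lt hfInf hc hP hQ hQrev _ rfl h1 _ _ _ hlt h2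
      exact ⟨A, L, B, M, h1.1.orient_eq hPs hQ, h2.1.orient_eq hPs hQ, h1.1.le_P, h2.1.le_P,
        by omega⟩
    have hsorted' := PlaneGraph.crossings_pairwise hQ hPs
    have hmem : ∀ Y, Y ∈ (G.crossings P Q).map (G.orient P) ↔ Y ∈ G.crossings Q P := by
      intro Y
      rw [List.mem_map, PlaneGraph.mem_crossings hQ hPs]
      constructor
      · rintro ⟨X, hX, rfl⟩
        obtain ⟨i, A, L, rfl, h⟩ := (PlaneGraph.mem_crossings hPs hQ).1 hX
        exact ⟨A, i, L, h.1.orient_eq hPs hQ, h.symm hPs hQ⟩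
      · rintro ⟨A, i, L, rfl, h⟩
        have h' := h.symm hQ hPs
        exact ⟨_, (PlaneGraph.mem_crossings hPs hQ).2 ⟨i, A, L, rfl, h'⟩,
          h'.1.orient_eq hPs hQ⟩
    have hnodup : ∀ {l : List (DartPath V D)}, l.Pairwise (G.StartsBefore P) → l.Nodup :=
      fun hl => hl.imp fun {X Y} h hXY => by
        subst hXY
        exact h.asymm hPs h
    have heq : (G.crossings P Q).map (G.orient P) = G.crossings Q P :=
      ((List.perm_ext_iff_of_nodup (hnodup hsorted) (hnodup hsorted')).2 hmem).eq_of_pairwise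
        (fun X Y _ _ h1 h2 => absurd h2 (h1.asymm hPs)) hsorted hsorted'
    rw [← heq, List.forall₂_map_right_iff, List.forall₂_same]
    intro X hX
    obtain ⟨i, A, L, rfl, h⟩ := (PlaneGraph.mem_crossings hPs hQ).1 hX
    unfold PlaneGraph.orient
    split_ifs
    · exact Or.inl rfl
    · exact Or.inr (PlaneGraph.revPath_revPath hQ (Nat.le_add_right _ _) h.1.le_Q).symm
  · obtain ⟨i, A, L, rfl, h⟩ := (PlaneGraph.mem_crossings hPs hQ).1 hX
    exact (PlaneGraph.crossesRightToLeft_iff hPs hQ).2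
      ⟨i, A, L, rfl, h.1, PlaneGraph.CrossesAt.entersRight hfInf hc hP hQ hQrev h⟩
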